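/- **Conventions.** For a partition $\lambda$ let $\lambda'$ be its conjugate, so $\lambda_1=\ell(\lambda')$; let $\delta_n=(n-1,n-2,\dots,1)$, and let $X_m=(x_1,\dots,x_m)$. Let $e_k(X_m)$ be the elementary symmetric polynomial ($e_k=0$ for $k<0$), and set $\binom{a}{b}=0$ for $b<0$. For $N\ge 0$ let $\mathcal A(\lambda;N)$ be the set of semistandard Young tableaux $T$ of shape $\lambda$ with entries in $\{1,\dots,N-1\}$ such that $T(i,j)\ge j$ for every cell $(i,j)$; for $\lambda\subset\delta_n$ put $\mathcal A_n(\lambda)=\mathcal A(\lambda;n)$. Let $n(T)$ be the number of entries of $T$ equal to $N-1$, and put $$\mathcal A_\lambda(N;t)=\sum_{T\in\mathcal A(\lambda;N)}t^{\lambda_1-n(T)}.$$ Define $$s^*_\lambda(X_N)=\det\bigl(e_{\lambda'_j-j+i}(X_{N-i})\bigr)_{1\le i,j\le\lambda_1}\quad(N\ge\lambda_1),$$ $$s^*_\lambda(X_N;t)=\det\bigl(x_{N-i}\,e_{\lambda'_j-j+i-1}(X_{N-i-1})+t\,e_{\lambda'_j-j+i}(X_{N-i-1})\bigr)_{1\le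 i,j\le\lambda_1}\quad(N>\lambda_1).$$ A TSSCPP of size $n$ is a totally symmetric self-complementary plane partition $\pi=(\pi_{i,j})_{1\le i,j\le 2n}$ in the box $2n\times2n\times2n$. For $\lambda\subset\delta_n$ let $\mathrm{TSSCPP}_n(\lambda)$ be the set of those with $2n-\pi_{i,i}=\lambda_{n+1-i}$ for $1\le i\le n$. The refined TSSCPP polynomials $P_n(r_1,\dots,r_{n-1}\,|\,t)$ for integers $r_1,\dots,r_{n-1}$ count families of nonintersecting lattice paths with steps $(0,1)$ and $(1,1)$, the $i$-th going from $(i,-i)$ to $(r_i,0)$, with weight $t$ for each vertical step in the top row. They are defined by $P_1=1$ and, for $n\ge2$, $$P_n(r_1,\dots,r_{n-1}\,|\,t)=\sum_{\varepsilon}t^{\#\{i:\varepsilon_i=0\}}\,P_{n-1}(r_2-\varepsilon_2-1,\dots,r_{n-1}-\varepsilon_{n-1}-1\,|\,1),$$ the sum over all $\varepsilon\in\{0,1\}^{n-1}$ with $1=r_1-\varepsilon_1<r_2-\varepsilon_2<\dots<r_{n-1}-\varepsilon_{n-1}$. Finally, $\mathfrak S_w$ is the Schubert polynomial of $w\in\mathbb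 S_N$: $\mathfrak S_{w_0}=x_1^{N-1}x_2^{N-2}\cdots x_{N-1}$ for the longest $w_0$, and $\mathfrak S_{ws_a}=\partial_a\mathfrak S_w$ if $w(a)>w(a+1)$, where $\partial_af=(f-s_af)/(x_a-x_{a+1})$. **Theorem.** 1. For $n\ge1$ and every partition $\lambda\subset\delta_n$ the number $|\mathcal A_n(\lambda)|$ is the refined TSSCPP number, $|\mathcal A_n(\lambda)|=|\mathrm{TSSCPP}_n(\lambda)|$. More precisely, $$t^{\,n-1-\lambda_1}\mathcal A_\lambda(n;t)=P_n(\lambda'_{n-1}+1,\dots,\lambda'_{n-i}+i,\dots,\lambda'_1+n-1\,|\,t)=\sum_{\pi\in\mathrm{TSSCPP}_n(\lambda)}t^{\,n-1-\sum_{i=2}^n(\pi_{i-1,i}-\pi_{i,i})}.$$ 2. For every partition $\lambda$ and every $N\ge\lambda_1$, $$|\mathcal A(\lambda;N)|=\det\left(\binom{N-i}{\lambda'_j-j+i}\right)_{1\le i,j\le\lambda_1},$$ and for $N>\lambda_1$, $$\mathcal A_\lambda(N;t)=\det\left(\binom{N-i-1}{\lambda'_j-j+i-1}+t\binom{N-i-1}{\lambda'_j-j+i}\right)_{1\le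 i,j\le\lambda_1}.$$ 3. For $N\ge\lambda_1$ the polynomial $s^*_\lambda(X_N)$ has nonnegative integer coefficients and takes the value $|\mathcal A(\lambda;N)|$ at $x_1=x_2=\dots=1$. For $N>\lambda_1$, $s^*_\lambda(X_N;1)=s^*_\lambda(X_N)$, and $s^*_\lambda(X_N;t)$ becomes $\mathcal A_\lambda(N;t)$ at $x_1=x_2=\dots=1$. 4. For all $n,k\ge0$, $$s^*_{(n^k)}(X_{n+k})=M_{n,k}(X_{n+k})\;\mathfrak S_{1^k\times w_0^{(n)}}(x_1^{-1},\dots,x_{n+k}^{-1}),$$ where $1^k\times w_0^{(n)}=[1,\dots,k,n+k,n+k-1,\dots,k+1]$ and $$M_{n,k}(X_{n+k})=\prod_{a=k+1}^{n+k}x_a^{-1}\prod_{a=1}^{n+k}x_a^{\min(n+k-a+1,\,n)}.$$ -/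

import Mathlib

open Finset

/-! ### Staircase tableaux

Partitions are Young diagrams (English notation, cells indexed from `0`): `μ.rowLen i` is the
part `λ_{i+1}`, and `μ.colLen j` is the part `λ'_{j+1}` of the conjugate partition. -/

/-- The staircase partition `δ_n = (n-1, n-2, …, 2, 1)`. -/
def staircase (n : ℕ) : YoungDiagram where
  cells := (range n ×ˢ range n).filter fun c => c.1 + c.2 + 2 ≤ n
  isLowerSet := by
    rintro ⟨a, b⟩ ⟨c, d⟩ ⟨h1, h2⟩ h
    simp only [coe_filter, mem_product, mem_range, Set.mem_ofPred_eq] at h ⊢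
    simp only at h1 h2
    omega

/-- The rectangular partition `(n^k)`, with `k` rows of length `n`. -/
def rectangle (n k : ℕ) : YoungDiagram where
  cells := range k ×ˢ range n
  isLowerSet := by
    rintro ⟨a, b⟩ ⟨c, d⟩ ⟨h1, h2⟩ h
    simp only [coe_product, coe_range, Set.mem_prod, Set.mem_Iio] at h ⊢
    simp only at h1 h2
    omega

/-- The set `A(λ; N)` of semistandard tableaux of shape `λ` with entries in `{1, …, N-1}` in which
every entry of the `j`-th column (`j = 1, 2, …`) is at least `j`. For `λ ⊂ δ_n` the set `A_n(λ)` is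
`A(λ; n)`. -/
def tableauSet (μ : YoungDiagram) (N : ℕ) : Set (SemistandardYoungTableau μ) :=
  {T | ∀ i j, (i, j) ∈ μ → j + 1 ≤ T i j ∧ T i j < N}

theorem tableauSet_finite (μ : YoungDiagram) (N : ℕ) : (tableauSet μ N).Finite := by
  refine Set.Finite.of_finite_image (f := fun T (c : μ.cells) => T c.1.1 c.1.2) ?_ ?_
  · refine (Set.Finite.pi' (t := fun _ : μ.cells => Set.Iio N)
      fun _ => Set.finite_Iio N).subset ?_
    rintro _ ⟨T, hT, rfl⟩ c
    exact (hT c.1.1 c.1.2 c.2).2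
  · intro T _ U _ h
    ext i j
    by_cases hc : (i, j) ∈ μ
    · exact congrFun h ⟨(i, j), hc⟩
    · rw [T.zeros hc, U.zeros hc]

/-- The finite set `A(λ; N)`. -/
noncomputable def tableaux (μ : YoungDiagram) (N : ℕ) : Finset (SemistandardYoungTableau μ) :=
  (tableauSet_finite μ N).toFinset

/-- The statistic `n(T)`: the number of entries equal to the largest admissible value `N-1`. -/
def topCount {μ : YoungDiagram} (N : ℕ) (T : SemistandardYoungTableau μ) : ℕ :=
  (μ.cells.filter fun c => T c.1 c.2 + 1 = N).card

/-- `A_λ(N; t) = ∑_{T ∈ A(λ; N)} t^(λ₁ - n(T))`. -/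
noncomputable def tableauPoly (μ : YoungDiagram) (N : ℕ) : Polynomial ℤ :=
  ∑ T ∈ tableaux μ N, Polynomial.X ^ (μ.rowLen 0 - topCount N T)

/-! ### Determinants -/

/-- The binomial coefficient with integer lower index, zero when the lower index is negative. -/
def binom (a : ℕ) (b : ℤ) : ℤ := if 0 ≤ b then (a.choose b.toNat : ℤ) else 0

/-- `det (binom (N-i) (λ'_j - j + i))` for `1 ≤ i, j ≤ λ₁`. -/
def binomDet (μ : YoungDiagram) (N : ℕ) : ℤ :=
  (Matrix.of fun i j : Fin (μ.rowLen 0) =>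
    binom (N - (i + 1)) ((μ.colLen j : ℤ) - j + i)).det

/-- `det (binom (N-i-1) (λ'_j - j + i - 1) + t * binom (N-i-1) (λ'_j - j + i))` for
`1 ≤ i, j ≤ λ₁`. -/
noncomputable def binomDetT (μ : YoungDiagram) (N : ℕ) : Polynomial ℤ :=
  (Matrix.of fun i j : Fin (μ.rowLen 0) =>
    Polynomial.C (binom (N - (i + 1) - 1) ((μ.colLen j : ℤ) - j + i - 1)) +
      Polynomial.X * Polynomial.C (binom (N - (i + 1) - 1) ((μ.colLen j : ℤ) - j + i))).det

/-- The elementary symmetric polynomial `e_k(X_m)` in the variables `X_m = {x_1, …, x_m}`, zero for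
negative `k`. -/
noncomputable def elemSymm (m : ℕ) (k : ℤ) : MvPolynomial ℕ ℤ :=
  if 0 ≤ k then ∑ S ∈ (Icc 1 m).powersetCard k.toNat, ∏ a ∈ S, MvPolynomial.X a else 0

/-- The column multi-Schur polynomial
`s*_λ(X_N) = det (e_{λ'_j - j + i}(X_{N-i}))`, `1 ≤ i, j ≤ λ₁`. -/
noncomputable def colMultiSchur (μ : YoungDiagram) (N : ℕ) : MvPolynomial ℕ ℤ :=
  (Matrix.of fun i j : Fin (μ.rowLen 0) =>
    elemSymm (N - (i + 1)) ((μ.colLen j : ℤ) - j + i)).det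

/-- The `t`-deformation
`s*_λ(X_N; t) = det (x_{N-i} e_{λ'_j - j + i - 1}(X_{N-i-1}) + t e_{λ'_j - j + i}(X_{N-i-1}))`,
`1 ≤ i, j ≤ λ₁`, as a polynomial in `t`. -/
noncomputable def colMultiSchurT (μ : YoungDiagram) (N : ℕ) : Polynomial (MvPolynomial ℕ ℤ) :=
  (Matrix.of fun i j : Fin (μ.rowLen 0) =>
    Polynomial.C (MvPolynomial.X (N - (i + 1)) *
        elemSymm (N - (i + 1) - 1) ((μ.colLen j : ℤ) - j + i - 1)) +
      Polynomial.X *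
        Polynomial.C (elemSymm (N - (i + 1) - 1) ((μ.colLen j : ℤ) - j + i))).det

/-! ### Totally symmetric self-complementary plane partitions -/

/-- A plane partition in the box of side `2n`, given as its set of unit cubes (coordinates from
`0`), is totally symmetric and self-complementary. -/
def IsTSSCPP (n : ℕ) (P : Finset (ℕ × ℕ × ℕ)) : Prop :=
  (∀ c ∈ P, c.1 < 2 * n ∧ c.2.1 < 2 * n ∧ c.2.2 < 2 * n) ∧
  (∀ c ∈ P, ∀ d, d ≤ c → d ∈ P) ∧
  (∀ i j k, (i, j, k) ∈ P → (j, i, k) ∈ P ∧ (i, k, j) ∈ P) ∧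
  (∀ i j k, i < 2 * n → j < 2 * n → k < 2 * n →
    ((i, j, k) ∈ P ↔ (2 * n - 1 - i, 2 * n - 1 - j, 2 * n - 1 - k) ∉ P))

open Classical in
/-- The finite set of totally symmetric self-complementary plane partitions in the box of side
`2n`. -/
noncomputable def tsscpp (n : ℕ) : Finset (Finset (ℕ × ℕ × ℕ)) :=
  ((range (2 * n) ×ˢ range (2 * n) ×ˢ range (2 * n)).powerset).filter (IsTSSCPP n)

/-- The entry `π_{i,j}` of a plane partition: the height of the column of cubes over `(i, j)`. -/
def ppHeight (P : Finset (ℕ × ℕ × ℕ)) (i j : ℕ) : ℕ :=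
  (P.filter fun c => c.1 = i ∧ c.2.1 = j).card

open Classical in
/-- The totally symmetric self-complementary plane partitions in the box of side `2n` whose
diagonal is prescribed by `λ`: `2n - π_{i,i} = λ_{n+1-i}` for `1 ≤ i ≤ n`. -/
noncomputable def refinedTSSCPP (n : ℕ) (μ : YoungDiagram) : Finset (Finset (ℕ × ℕ × ℕ)) :=
  (tsscpp n).filter fun P => ∀ i < n, ppHeight P i i + μ.rowLen (n - 1 - i) = 2 * n

/-- The generating polynomial of `refinedTSSCPP n λ` with respect to
`n - 1 - ∑_{i=2}^{n} (π_{i-1,i} - π_{i,i})`. -/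
noncomputable def refinedTSSCPPPoly (n : ℕ) (μ : YoungDiagram) : Polynomial ℤ :=
  ∑ P ∈ refinedTSSCPP n μ, Polynomial.X ^
    (n - 1 - ∑ i ∈ range (n - 1), (ppHeight P i (i + 1) - ppHeight P (i + 1) (i + 1)))

open Classical in
/-- The recursively defined polynomials `P(r_1, …, r_m | t)` counting families of `m`
nonintersecting lattice paths with vertical steps `(0, 1)` and diagonal steps `(1, 1)`, the `i`-th
path going from `(i, -i)` to `(r_i, 0)`, with weight `t` for each vertical step in the top row.
Removing the top row of steps (`D` is the set of paths whose top step is diagonal) leaves the points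
`s_i` in height `-1`; there the first path has length zero, and the others form a family of `m - 1`
paths, shifted by `(-1, 1)`. -/
noncomputable def pathPoly : (m : ℕ) → (Fin m → ℤ) → Polynomial ℤ
  | 0, _ => 1
  | m + 1, r => ∑ D : Finset (Fin (m + 1)),
      if (fun i => r i - if i ∈ D then 1 else 0) 0 = 1 ∧
          StrictMono (fun i => r i - if i ∈ D then 1 else 0) then
        Polynomial.X ^ (Dᶜ).card * Polynomial.C
          ((pathPoly m fun i => r i.succ - (if i.succ ∈ D then 1 else 0) - 1).eval 1)
      else 0

/-- The end points `(λ'_{n-1} + 1, …, λ'_{n-i} + i, …, λ'_1 + n - 1)`. -/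
def endPoints (n : ℕ) (μ : YoungDiagram) : Fin (n - 1) → ℤ :=
  fun i => (μ.colLen (n - 1 - (i + 1)) : ℤ) + (i + 1)

/-! ### Schubert polynomials -/

theorem divDiff_exists (a : ℕ) (f : MvPolynomial ℕ ℤ) :
    ∃ g : MvPolynomial ℕ ℤ, f - MvPolynomial.rename (Equiv.swap a (a + 1)) f =
      (MvPolynomial.X a - MvPolynomial.X (a + 1)) * g := by
  induction f using MvPolynomial.induction_on with
  | C c => exact ⟨0, by simp⟩
  | add p q hp hq =>
    obtain ⟨g, hg⟩ := hp
    obtain ⟨h, hh⟩ := hq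
    exact ⟨g + h, by rw [map_add, mul_add, ← hg, ← hh]; ring⟩
  | mul_X p b hp =>
    obtain ⟨g, hg⟩ := hp
    rw [map_mul, MvPolynomial.rename_X]
    have hb : ∃ c : MvPolynomial ℕ ℤ,
        (MvPolynomial.X b - MvPolynomial.X (Equiv.swap a (a + 1) b) : MvPolynomial ℕ ℤ) =
          (MvPolynomial.X a - MvPolynomial.X (a + 1)) * c := by
      by_cases h1 : b = a
      · subst h1
        exact ⟨1, by simp⟩
      · by_cases h2 : b = a + 1
        · subst h2
          exact ⟨-1, by simp⟩
        · exact ⟨0, by rw [Equiv.swap_apply_of_ne_of_ne h1 h2]; simp⟩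
    obtain ⟨c, hc⟩ := hb
    refine ⟨g * MvPolynomial.X b + MvPolynomial.rename (Equiv.swap a (a + 1)) p * c, ?_⟩
    rw [mul_add, ← mul_assoc, ← hg, mul_left_comm, ← hc]
    ring

/-- The Newton divided difference `∂_a f = (f - s_a f) / (x_a - x_{a+1})`. -/
noncomputable def divDiff (a : ℕ) (f : MvPolynomial ℕ ℤ) : MvPolynomial ℕ ℤ :=
  Classical.choose (divDiff_exists a f)

/-- The ascents of `w` among the positions `1, …, N-1`. -/
def ascents (N : ℕ) (w : Equiv.Perm ℕ) : Finset ℕ :=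
  (Ico 1 N).filter fun a => w a < w (a + 1)

theorem ascent_measure (N : ℕ) (w : Equiv.Perm ℕ) (a : ℕ) (ha : a ∈ ascents N w) :
    ∑ x ∈ range (N + 1), x * (w * Equiv.swap a (a + 1)) x < ∑ x ∈ range (N + 1), x * w x := by
  simp only [ascents, mem_filter, mem_Ico] at ha
  obtain ⟨⟨h1, h2⟩, h3⟩ := ha
  have hne : a ≠ a + 1 := by omega
  have hsub : ({a, a + 1} : Finset ℕ) ⊆ range (N + 1) := by
    intro x hx
    simp only [mem_insert, mem_singleton] at hx
    simp only [mem_range]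
    omega
  rw [← sum_sdiff hsub, ← sum_sdiff (f := fun x => x * w x) hsub]
  have hrest : ∑ x ∈ range (N + 1) \ {a, a + 1}, x * (w * Equiv.swap a (a + 1)) x =
      ∑ x ∈ range (N + 1) \ {a, a + 1}, x * w x := by
    refine sum_congr rfl fun x hx => ?_
    simp only [mem_sdiff, mem_insert, mem_singleton, not_or] at hx
    rw [Equiv.Perm.mul_apply, Equiv.swap_apply_of_ne_of_ne hx.2.1 hx.2.2]
  rw [hrest, sum_pair hne, sum_pair hne]
  simp only [Equiv.Perm.mul_apply, Equiv.swap_apply_left, Equiv.swap_apply_right]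
  nlinarith

/-- The Schubert polynomial of a permutation `w` of `{1, …, N}` (extended to `ℕ` by fixed points):
`x_1^{N-1} x_2^{N-2} ⋯ x_{N-1}` for the longest permutation, which is the one without ascents, and
`∂_a 𝔖_{w s_a}` if `a` is an ascent of `w`. Unrolled, this is
`∂_{w⁻¹ w₀} (x_1^{N-1} x_2^{N-2} ⋯ x_{N-1})`, computed along one reduced word of `w⁻¹ w₀`; by the
braid relations the choice of the ascent does not matter, and the last one is taken. -/
noncomputable def schubert (N : ℕ) (w : Equiv.Perm ℕ) : MvPolynomial ℕ ℤ :=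
  if h : (ascents N w).Nonempty then
    divDiff ((ascents N w).max' h)
      (schubert N (w * Equiv.swap ((ascents N w).max' h) ((ascents N w).max' h + 1)))
  else ∏ a ∈ Icc 1 N, MvPolynomial.X a ^ (N - a)
termination_by ∑ x ∈ range (N + 1), x * w x
decreasing_by exact ascent_measure N w _ (max'_mem _ h)

/-- The permutation `1^k × w₀^{(n)} = [1, …, k, n+k, n+k-1, …, k+1]`. -/
def richardson (n k : ℕ) : Equiv.Perm ℕ :=
  Function.Involutive.toPerm
    (fun a => if k < a ∧ a ≤ k + n then n + 2 * k + 1 - a else a) (by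
      intro a
      by_cases h : k < a ∧ a ≤ k + n
      · have h' : k < n + 2 * k + 1 - a ∧ n + 2 * k + 1 - a ≤ k + n := by omega
        simp only [h, h', and_self, if_true]
        omega
      · simp only [h, if_false])

/-- The field of rational functions in the variables `x_a`. -/
abbrev RatFun : Type := FractionRing (MvPolynomial ℕ ℤ)

/-- The variable `x_a` as a rational function. -/
noncomputable def ratVar (a : ℕ) : RatFun := algebraMap (MvPolynomial ℕ ℤ) RatFun (MvPolynomial.X a)

/-- The monomial `M_{n,k} = ∏_{a=k+1}^{n+k} x_a⁻¹ * ∏_{a=1}^{n+k} x_a^{min(n+k-a+1, n)}`. -/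
noncomputable def monomialM (n k : ℕ) : RatFun :=
  (∏ a ∈ Icc (k + 1) (n + k), (ratVar a)⁻¹) *
    ∏ a ∈ Icc 1 (n + k), ratVar a ^ min (n + k - a + 1) n

/-!
Everything that is counted or expanded here obeys one recursion, `columnSum a b N L`, in the column
lengths `L` of a partition: choose the set `D` of columns which lose their last cell, weight the
columns in `D` by `a`, the others by `b`, and go on with `N - 1`.

* For tableaux, `D` is the set of columns containing the largest entry (`sum_tableauWeight`).
* For determinants with entries built from a Pascal-type recursion (binomial coefficients,
  elementary symmetric polynomials), expand every column into the two terms of the recursion. The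
  summands in which `L` minus the indicator of `D` is not a partition have two equal columns or a
  zero column (`det_stepMatrix`). The step for the largest admissible entry involves all columns
  `1, …, N - 1`, because a column `j` admits exactly the entries `j, …, N - 1`; a column that admits
  no entry must be empty and splits off.
* For lattice paths, `D` is the set of diagonal steps in the top row (`pathPoly_eq_columnSum`).

Choosing the weights gives the binomial determinants, `colMultiSchur` and its deformation; the
nonnegativity of coefficients holds because the recursion makes sense over `ℕ`.

A plane partition that is totally symmetric and self-complementary is determined by its cubes
`(i, j, k)` with `i ≤ j < n ≤ k`, and these can be prescribed by any increasing array subject to a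
single bound (`isTSSCPP_boxPartition`). Read along diagonals, this array is the Gelfand–Tsetlin
pattern of a tableau (`Corresponds`), the bound being the condition on the columns.

The Schubert polynomial of `1^k × w₀` is the flagged determinant `flagDet` in elementary symmetric
polynomials. For `k = 0` this determinant is triangular. Passing from `k` to `k + 1` takes one
divided difference for each row but the last; each acts on a single row, after one row operation
(`divDiff_det_stageMatrix`). Inverting the variables turns `e_r(X_m)` into `e_{m-r}(X_m)` divided by
`x_1 ⋯ x_m`, and thereby `flagDet` into the determinant of the rectangle.
-/

/-! ### The recursion and its determinants -/

/-- The column lengths `L` after the last cell of every column in `D` has been removed. -/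
def removeCells (L : ℕ → ℕ) (D : Finset ℕ) : ℕ → ℕ :=
  fun j => L j - if j ∈ D then 1 else 0

open Classical in
/-- The generating function of all ways to empty columns of lengths `L` in `N` steps. In the step
with number `v`, at most one cell is removed from each of the first `v` columns, with weight `a v`
for a column that loses a cell and `b v` for one that does not; the remaining lengths must form a
partition, and the columns that take no further part must be empty. -/
noncomputable def columnSum {R : Type*} [CommSemiring R] (a b : ℕ → R) : ℕ → (ℕ → ℕ) → R
  | 0, _ => 1
  | N + 1, L =>
      if L N = 0 then
        ∑ D ∈ (range N).powerset with (∀ j ∈ D, 0 < L j) ∧ Antitone (removeCells L D),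
          a N ^ D.card * b N ^ (N - D.card) * columnSum a b N (removeCells L D)
      else 0

/-- The coefficient of `z ^ k` in `∏ (a v * z + b v)`, the product running over the `s` indices
`v = i + 1, …, i + s`. It is zero for negative `k`. -/
def stepCoeff {R : Type*} [CommSemiring R] (a b : ℕ → R) (i : ℕ) : ℕ → ℤ → R
  | 0, k => if k = 0 then 1 else 0
  | s + 1, k => a (i + 1 + s) * stepCoeff a b i s (k - 1) + b (i + 1 + s) * stepCoeff a b i s k

theorem stepCoeff_neg {R : Type*} [CommSemiring R] (a b : ℕ → R) (i s : ℕ) :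
    ∀ k : ℤ, k < 0 → stepCoeff a b i s k = 0 := by
  induction s with
  | zero => intro k hk; simp [stepCoeff, hk.ne]
  | succ s ih => intro k hk; simp [stepCoeff, ih k hk, ih (k - 1) (by omega)]

theorem stepCoeff_zero {R : Type*} [CommSemiring R] (a b : ℕ → R) (i s : ℕ) :
    stepCoeff a b i s 0 = ∏ u ∈ range s, b (i + 1 + u) := by
  induction s with
  | zero => simp [stepCoeff]
  | succ s ih => simp [stepCoeff, ih, stepCoeff_neg, prod_range_succ, mul_comm]

/-- The `m × m` matrix with entries `stepCoeff` of degree `c j + i`, where row `i` takes the factors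
with indices `i + 1, …, N - 1`. -/
def stepMatrix {R : Type*} [CommSemiring R] (a b : ℕ → R) (N m : ℕ) (c : ℕ → ℤ) :
    Matrix (Fin m) (Fin m) R :=
  Matrix.of fun i j => stepCoeff a b i (N - (i + 1)) (c j + i)

theorem det_add_mul_columns {R : Type*} [CommRing R] {m : ℕ} (x y : R)
    (U V : Matrix (Fin m) (Fin m) R) :
    (Matrix.of fun i j => x * U i j + y * V i j).det =
      ∑ s : Finset (Fin m), x ^ s.card * y ^ (m - s.card) *
        (Matrix.of fun i j => if j ∈ s then U i j else V i j).det := by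
  rw [← Matrix.det_transpose]
  have h := (Matrix.detRowAlternating (n := Fin m) (R := R)).toMultilinearMap.map_add_univ
    (fun j i => x * U i j) (fun j i => y * V i j)
  refine h.trans (sum_congr rfl fun s _ => ?_)
  have h2 := Matrix.det_mul_row (fun j => if j ∈ s then x else y)
    (Matrix.of fun i j => if j ∈ s then U i j else V i j)
  rw [prod_ite, prod_const, prod_const] at h2
  have h3 : (univ.filter fun j => j ∈ s) = s := by ext; simp
  have h4 : (univ.filter fun j => j ∉ s) = sᶜ := by ext; simp
  rw [h3, h4, card_compl, Fintype.card_fin] at h2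
  rw [← h2, ← Matrix.det_transpose]
  change Matrix.det _ = Matrix.det _
  congr 1
  ext j i
  simp only [Finset.piecewise, Matrix.transpose_apply, Matrix.of_apply]
  split_ifs <;> rfl

/-- Unless removing the last cells of the columns in `D` leaves a partition, the matrix has two
equal adjacent columns, or its last column is zero. -/
theorem det_stepMatrix_eq_zero {R : Type*} [CommRing R] (a b : ℕ → R) {N : ℕ} {L : ℕ → ℕ}
    (hL : Antitone L) (hN : L N = 0) {D : Finset ℕ} (hD : D ⊆ range N)
    (h : ¬ ((∀ j ∈ D, 0 < L j) ∧ Antitone (removeCells L D))) :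
    (stepMatrix a b N N fun j => (L j : ℤ) - (if j ∈ D then 1 else 0) - j).det = 0 := by
  by_contra hne
  -- The subtraction keeps the sequence `L j - j` weakly decreasing, so if two adjacent column
  -- lengths get out of order, the corresponding columns of the matrix are equal.
  have hstep : ∀ j, j + 1 < N →
      (L (j + 1) : ℤ) - (if j + 1 ∈ D then 1 else 0) ≤ L j - (if j ∈ D then 1 else 0) := by
    intro j hj
    by_contra hlt
    refine hne (Matrix.det_zero_of_column_eq (i := ⟨j, by omega⟩) (j := ⟨j + 1, hj⟩)
      (by simp) fun i => ?_)
    have := hL (show j ≤ j + 1 by omega)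
    simp only [stepMatrix, Matrix.of_apply]
    congr 1
    push_cast
    split_ifs at hlt ⊢ <;> omega
  -- If the last column length gets negative, all degrees in the last column are negative.
  have hlast : ∀ j, j + 1 = N → (0 : ℤ) ≤ L j - (if j ∈ D then 1 else 0) := by
    intro j hj
    by_contra hlt
    refine hne (Matrix.det_eq_zero_of_column_eq_zero ⟨j, by omega⟩ fun i => ?_)
    simp only [stepMatrix, Matrix.of_apply]
    exact stepCoeff_neg _ _ _ _ _ (by have := i.2; omega)
  have hpos : ∀ d j, j + 1 + d = N → (0 : ℤ) ≤ L j - (if j ∈ D then 1 else 0) := by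
    intro d
    induction d with
    | zero => exact fun j hj => hlast j hj
    | succ d ih => exact fun j hj => (ih (j + 1) (by omega)).trans (hstep j (by omega))
  refine h ⟨fun j hj => ?_, antitone_nat_of_succ_le fun j => ?_⟩
  · have hjN := mem_range.1 (hD hj)
    have := hpos (N - (j + 1)) j (by omega)
    rw [if_pos hj] at this
    omega
  · simp only [removeCells]
    by_cases hj : j + 1 < N
    · have := hstep j hj
      have := hpos (N - (j + 1)) j (by omega)
      split_ifs at * <;> omega
    · have : L (j + 1) = 0 := by have := hL (show N ≤ j + 1 by omega); omega
      omega

/-- In the matrix of size `N + 1` the last row has no factors and nonnegative degrees, so that only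
its last entry can be nonzero; all other rows contain the factor with index `N`. -/
theorem det_stepMatrix {R : Type*} [CommRing R] (a b : ℕ → R) (N : ℕ) :
    ∀ L : ℕ → ℕ, Antitone L →
      (stepMatrix a b N N fun j => (L j : ℤ) - j).det = columnSum a b N L := by
  classical
  induction N with
  | zero => intro L _; simp [columnSum]
  | succ N ih =>
    intro L hL
    have hcorner : (stepMatrix a b (N + 1) (N + 1) fun j => (L j : ℤ) - j).det =
        (if L N = 0 then 1 else 0) *
          ((stepMatrix a b (N + 1) (N + 1) fun j => (L j : ℤ) - j).submatrix
            Fin.castSucc Fin.castSucc).det := by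
      rw [Matrix.det_succ_row _ (Fin.last N), Fin.sum_univ_castSucc, sum_eq_zero, zero_add]
      · simp only [Fin.succAbove_last]
        congr 1
        simp [stepMatrix, stepCoeff, ← two_mul]
      · intro j _
        have := j.2
        have h0 : ((L j : ℤ) - j + N) ≠ 0 := by omega
        simp [stepMatrix, stepCoeff, h0]
    rw [hcorner, columnSum]
    split_ifs with hN
    · rw [one_mul]
      have hsub : (stepMatrix a b (N + 1) (N + 1) fun j => (L j : ℤ) - j).submatrix
          Fin.castSucc Fin.castSucc = Matrix.of fun i j => a N *
            stepMatrix a b N N (fun j => (L j : ℤ) - 1 - j) i j +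
            b N * stepMatrix a b N N (fun j => (L j : ℤ) - j) i j := by
        ext i j
        have hi : N + 1 - (i + 1) = (N - (i + 1)) + 1 := by have := i.2; omega
        have hi' : (i : ℕ) + 1 + (N - (i + 1)) = N := by have := i.2; omega
        simp only [stepMatrix, Matrix.submatrix_apply, Matrix.of_apply, Fin.val_castSucc, hi,
          stepCoeff, hi']
        congr 3
        ring
      rw [hsub, det_add_mul_columns, sum_filter]
      refine sum_nbij (fun s => s.map Fin.valEmbedding) ?_ ?_ ?_ ?_
      · intro s _
        simp only [mem_powerset]
        intro x hx
        obtain ⟨y, -, rfl⟩ := mem_map.1 hx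
        simp
      · exact fun s _ t _ h => map_injective _ h
      · intro D hD
        have hD' := mem_powerset.1 (mem_coe.1 hD)
        refine ⟨univ.filter fun i => (i : ℕ) ∈ D, by simp, ?_⟩
        ext x
        simp only [mem_map, mem_filter, mem_univ, true_and, Fin.valEmbedding_apply]
        constructor
        · rintro ⟨i, hi, rfl⟩; exact hi
        · exact fun hx => ⟨⟨x, mem_range.1 (hD' hx)⟩, hx, rfl⟩
      · intro s _
        rw [card_map]
        set D := s.map Fin.valEmbedding with hDdef
        have hD : D ⊆ range N := by
          intro x hx
          obtain ⟨y, -, rfl⟩ := mem_map.1 hx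
          simp
        have hmem : ∀ j : Fin N, j ∈ s ↔ (j : ℕ) ∈ D := by
          intro j
          simp [hDdef, Fin.val_inj]
        have hmat : (Matrix.of fun i j => if j ∈ s then
            stepMatrix a b N N (fun j => (L j : ℤ) - 1 - j) i j else
            stepMatrix a b N N (fun j => (L j : ℤ) - j) i j) =
            stepMatrix a b N N fun j => (L j : ℤ) - (if j ∈ D then 1 else 0) - j := by
          ext i j
          simp only [stepMatrix, Matrix.of_apply, hmem]
          split_ifs <;> simp
        rw [hmat]
        split_ifs with hv
        · rw [← ih _ hv.2]
          congr 3
          ext j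
          simp only [removeCells]
          by_cases hj : j ∈ D
          · have := hv.1 j hj
            simp only [hj, if_true]
            omega
          · simp [hj]
        · rw [det_stepMatrix_eq_zero a b hL hN hD hv, mul_zero]
    · rw [zero_mul]

/-- Empty columns can be added: the matrix becomes block triangular. -/
theorem det_stepMatrix_pad {R : Type*} [CommRing R] (a b : ℕ → R) (N m d : ℕ) {L : ℕ → ℕ}
    (hL : ∀ j, m ≤ j → L j = 0) :
    (stepMatrix a b N (m + d) fun j => (L j : ℤ) - j).det =
      (stepMatrix a b N m fun j => (L j : ℤ) - j).det *
        ∏ e ∈ range d, stepCoeff a b (m + e) (N - (m + e + 1)) 0 := by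
  induction d with
  | zero => simp
  | succ d ih =>
    rw [prod_range_succ, ← mul_assoc, ← ih]
    change (stepMatrix a b N (m + d + 1) fun j => (L j : ℤ) - j).det = _
    rw [Matrix.det_succ_column _ (Fin.last (m + d)), Fin.sum_univ_castSucc, sum_eq_zero, zero_add,
      mul_comm]
    · simp only [Fin.succAbove_last]
      congr 1
      simp [stepMatrix, ← two_mul, hL]
    · intro i _
      have := i.2
      have h0 : stepCoeff a b i (N - (i + 1)) ((L (m + d) : ℤ) - (m + d : ℕ) + i) = 0 :=
        stepCoeff_neg _ _ _ _ _ (by rw [hL (m + d) (by omega)]; omega)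
      simp only [Fin.val_castSucc, stepMatrix, Matrix.of_apply, Fin.val_last, h0]
      simp

/-! ### Removing the largest entries of a tableau -/

theorem mem_tableaux {μ : YoungDiagram} {N : ℕ} {T : SemistandardYoungTableau μ} :
    T ∈ tableaux μ N ↔ ∀ i j, (i, j) ∈ μ → j + 1 ≤ T i j ∧ T i j < N := by
  simp [tableaux, tableauSet]

/-- The number of entries of `T` equal to `v`. -/
def entryCount {μ : YoungDiagram} (v : ℕ) (T : SemistandardYoungTableau μ) : ℕ :=
  (μ.cells.filter fun c => T c.1 c.2 = v).card

/-- The weight of a tableau: a factor `a v` for every entry `v < N`, and a factor `b v` for each of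
the `v` columns that admit the entry `v` but do not contain it. -/
def tableauWeight {R : Type*} [CommSemiring R] (a b : ℕ → R) (N : ℕ) {μ : YoungDiagram}
    (T : SemistandardYoungTableau μ) : R :=
  ∏ v ∈ range N, a v ^ entryCount v T * b v ^ (v - entryCount v T)

theorem exists_colLen_eq {L : ℕ → ℕ} (hL : Antitone L) {N : ℕ} (hN : L N = 0) :
    ∃ ν : YoungDiagram, ν.colLen = L := by
  refine ⟨⟨(range (L 0) ×ˢ range N).filter fun c => c.1 < L c.2, ?_⟩, ?_⟩
  · rintro ⟨a, b⟩ ⟨c, d⟩ ⟨h1, h2⟩ h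
    simp only [coe_filter, mem_product, mem_range, Set.mem_ofPred_eq] at h ⊢
    simp only at h1 h2
    have := hL h2
    omega
  · ext j
    refine eq_of_forall_lt_iff fun i => ?_
    rw [← YoungDiagram.mem_iff_lt_colLen, ← YoungDiagram.mem_cells, mem_filter, mem_product,
      mem_range, mem_range]
    have h0 := hL (Nat.zero_le j)
    refine ⟨fun h => h.2, fun h => ⟨⟨by simp only; omega, ?_⟩, h⟩⟩
    by_contra hj
    have := hL (show N ≤ j from not_lt.1 hj)
    omega

/-- The columns in which a tableau contains the entry `v`. -/
def columnsWith {μ : YoungDiagram} (v : ℕ) (T : SemistandardYoungTableau μ) : Finset ℕ :=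
  (μ.cells.filter fun c => T c.1 c.2 = v).image Prod.snd

theorem mem_columnsWith {μ : YoungDiagram} {v j : ℕ} {T : SemistandardYoungTableau μ} :
    j ∈ columnsWith v T ↔ ∃ i, (i, j) ∈ μ ∧ T i j = v := by
  simp [columnsWith]

theorem card_columnsWith {μ : YoungDiagram} (v : ℕ) (T : SemistandardYoungTableau μ) :
    (columnsWith v T).card = entryCount v T := by
  refine card_image_of_injOn ?_
  rintro ⟨i, j⟩ h ⟨i', j'⟩ h' rfl
  simp only [coe_filter, Set.mem_ofPred_eq, YoungDiagram.mem_cells] at h h'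
  rcases lt_trichotomy i i' with hlt | rfl | hlt
  · have := T.col_strict hlt h'.1; dsimp only at *; omega
  · rfl
  · have := T.col_strict hlt h.1; dsimp only at *; omega

/-- Deleting the largest entries leaves the diagram with columns `removeCells μ.colLen D`. -/
theorem mem_tableaux_lt_iff {μ : YoungDiagram} {N : ℕ} {T : SemistandardYoungTableau μ}
    (hT : T ∈ tableaux μ (N + 1)) {i j : ℕ} :
    (i, j) ∈ μ ∧ T i j < N ↔ i < removeCells μ.colLen (columnsWith N T) j := by
  have hmem := @YoungDiagram.mem_iff_lt_colLen μ
  simp only [removeCells]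
  by_cases hj : j ∈ columnsWith N T
  · obtain ⟨i₀, h₀, hv⟩ := mem_columnsWith.1 hj
    have hlast : i₀ + 1 = μ.colLen j := by
      by_contra hne
      have h1 : (i₀ + 1, j) ∈ μ := hmem.2 (by have := hmem.1 h₀; omega)
      have := T.col_strict (Nat.lt_succ_self i₀) h1
      have := (mem_tableaux.1 hT _ _ h1).2
      simp only [Nat.succ_eq_add_one] at *
      omega
    rw [if_pos hj]
    constructor
    · rintro ⟨hc, hlt⟩
      have h1 := hmem.1 hc
      have : i ≠ i₀ := by rintro rfl; omega
      omega
    · intro hi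
      have := T.col_strict (show i < i₀ by omega) h₀
      exact ⟨hmem.2 (by omega), by omega⟩
  · rw [if_neg hj, Nat.sub_zero, ← hmem]
    refine ⟨fun h => h.1, fun h => ⟨h, ?_⟩⟩
    have h1 := (mem_tableaux.1 hT _ _ h).2
    have h2 : T i j ≠ N := fun h2 => hj (mem_columnsWith.2 ⟨i, h, h2⟩)
    omega

theorem columnsWith_subset {μ : YoungDiagram} {N : ℕ} {T : SemistandardYoungTableau μ}
    (hT : T ∈ tableaux μ (N + 1)) : columnsWith N T ⊆ range N := by
  intro j hj
  obtain ⟨i, h, hv⟩ := mem_columnsWith.1 hj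
  have := (mem_tableaux.1 hT _ _ h).1
  exact mem_range.2 (by omega)

theorem columnsWith_pos {μ : YoungDiagram} {N : ℕ} {T : SemistandardYoungTableau μ} {j : ℕ}
    (hj : j ∈ columnsWith N T) : 0 < μ.colLen j := by
  obtain ⟨i, h, -⟩ := mem_columnsWith.1 hj
  have := YoungDiagram.mem_iff_lt_colLen.1 h
  omega

theorem antitone_removeCells_columnsWith {μ : YoungDiagram} {N : ℕ}
    {T : SemistandardYoungTableau μ} (hT : T ∈ tableaux μ (N + 1)) :
    Antitone (removeCells μ.colLen (columnsWith N T)) := by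
  intro j j' hj
  refine le_of_forall_lt fun i hi => ?_
  obtain ⟨h1, h2⟩ := (mem_tableaux_lt_iff hT).2 hi
  exact (mem_tableaux_lt_iff hT).1
    ⟨μ.up_left_mem le_rfl hj h1, (T.row_weak_of_le hj h1).trans_lt h2⟩

/-- The part of a tableau inside a smaller diagram `ν`. -/
def restrictTableau {μ ν : YoungDiagram} (h : ν ≤ μ) (T : SemistandardYoungTableau μ) :
    SemistandardYoungTableau ν where
  entry i j := if (i, j) ∈ ν then T i j else 0
  row_weak' := by
    intro i j1 j2 hj hc
    rw [if_pos hc, if_pos (ν.up_left_mem le_rfl hj.le hc)]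
    exact T.row_weak hj (h hc)
  col_strict' := by
    intro i1 i2 j hi hc
    rw [if_pos hc, if_pos (ν.up_left_mem hi.le le_rfl hc)]
    exact T.col_strict hi (h hc)
  zeros' := fun hc => if_neg hc

/-- The tableau obtained by filling the cells of `μ` outside `ν` with an entry `N`, provided these
cells form a horizontal strip and `N` exceeds the given entries. -/
def extendTableau {μ ν : YoungDiagram} (N : ℕ) (T : SemistandardYoungTableau ν)
    (hT : ∀ i j, (i, j) ∈ ν → T i j < N) (h : ∀ i j, (i + 1, j) ∈ μ → (i, j) ∈ ν) :
    SemistandardYoungTableau μ where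
  entry i j := if (i, j) ∈ μ then (if (i, j) ∈ ν then T i j else N) else 0
  row_weak' := by
    intro i j1 j2 hj hc
    rw [if_pos hc, if_pos (μ.up_left_mem le_rfl hj.le hc)]
    by_cases h2 : (i, j2) ∈ ν
    · rw [if_pos h2, if_pos (ν.up_left_mem le_rfl hj.le h2)]
      exact T.row_weak hj h2
    · rw [if_neg h2]
      split_ifs with h1
      · exact (hT _ _ h1).le
      · exact le_rfl
  col_strict' := by
    intro i1 i2 j hi hc
    obtain ⟨i3, rfl⟩ : ∃ i3, i2 = i3 + 1 := ⟨i2 - 1, by omega⟩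
    have h1 : (i1, j) ∈ ν := ν.up_left_mem (Nat.lt_succ_iff.1 hi) le_rfl (h _ _ hc)
    rw [if_pos hc, if_pos (μ.up_left_mem hi.le le_rfl hc), if_pos h1]
    split_ifs with h2
    · exact T.col_strict hi h2
    · exact hT _ _ h1
  zeros' := fun hc => if_neg hc

/-- Restricting a tableau to its entries less than `N` is a bijection between the tableaux that have
an entry `N` exactly in the columns `D` and the tableaux of the remaining shape. -/
theorem sum_tableaux_fiber {R : Type*} [CommSemiring R] (a b : ℕ → R) {N : ℕ}
    {μ ν : YoungDiagram} {D : Finset ℕ} (hpos : ∀ j ∈ D, 0 < μ.colLen j) (hD : D ⊆ range N)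
    (hν : ν.colLen = removeCells μ.colLen D) :
    ∑ T ∈ tableaux μ (N + 1) with columnsWith N T = D, tableauWeight a b (N + 1) T =
      a N ^ D.card * b N ^ (N - D.card) * ∑ T ∈ tableaux ν N, tableauWeight a b N T := by
  have hmemμ := @YoungDiagram.mem_iff_lt_colLen μ
  have hmemν := @YoungDiagram.mem_iff_lt_colLen ν
  rw [hν] at hmemν
  have hle : ν ≤ μ := by
    rintro ⟨i, j⟩ h
    have := hmemν.1 h
    simp only [removeCells] at this
    exact hmemμ.2 (by omega)
  have hstrip : ∀ i j, (i + 1, j) ∈ μ → (i, j) ∈ ν := by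
    intro i j h
    have := hmemμ.1 h
    refine hmemν.2 ?_
    simp only [removeCells]
    split_ifs <;> omega
  have hout : ∀ i j, (i, j) ∈ μ → (i, j) ∉ ν → j ∈ D := by
    intro i j h h'
    by_contra hj
    refine h' (hmemν.2 ?_)
    simp only [removeCells, if_neg hj]
    exact hmemμ.1 h
  rw [mul_sum]
  refine sum_bij' (fun T _ => restrictTableau hle T)
    (fun T hT => extendTableau N T (fun i j h => (mem_tableaux.1 hT i j h).2) hstrip) ?_ ?_ ?_ ?_ ?_
  · intro T hT
    obtain ⟨hTm, rfl⟩ := mem_filter.1 hT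
    refine mem_tableaux.2 fun i j h => ?_
    have h2 := (mem_tableaux_lt_iff hTm).2 (hmemν.1 h)
    change j + 1 ≤ (if (i, j) ∈ ν then T i j else 0) ∧ (if (i, j) ∈ ν then T i j else 0) < N
    rw [if_pos h]
    exact ⟨(mem_tableaux.1 hTm _ _ h2.1).1, h2.2⟩
  · intro T hT
    have hent : ∀ i j, extendTableau N T (fun i j h => (mem_tableaux.1 hT i j h).2) hstrip i j =
        if (i, j) ∈ μ then (if (i, j) ∈ ν then T i j else N) else 0 := fun _ _ => rfl
    refine mem_filter.2 ⟨mem_tableaux.2 fun i j h => ?_, ?_⟩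
    · rw [hent, if_pos h]
      split_ifs with h'
      · have := mem_tableaux.1 hT _ _ h'
        omega
      · have := mem_range.1 (hD (hout i j h h'))
        omega
    · ext j
      rw [mem_columnsWith]
      constructor
      · rintro ⟨i, h, hv⟩
        rw [hent, if_pos h] at hv
        split_ifs at hv with h'
        · have := mem_tableaux.1 hT _ _ h'
          omega
        · exact hout i j h h'
      · intro hj
        have := hpos j hj
        have h1 : (μ.colLen j - 1, j) ∈ μ := hmemμ.2 (by omega)
        have h2 : (μ.colLen j - 1, j) ∉ ν := by
          rw [hmemν, removeCells, if_pos hj]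
          omega
        exact ⟨_, h1, by rw [hent, if_pos h1, if_neg h2]⟩
  · intro T hT
    obtain ⟨hTm, rfl⟩ := mem_filter.1 hT
    ext i j
    change (if (i, j) ∈ μ then
      (if (i, j) ∈ ν then (if (i, j) ∈ ν then T i j else 0) else N) else 0) = T i j
    split_ifs with h1 h2
    · rfl
    · have h3 := (mem_tableaux.1 hTm _ _ h1).2
      have h4 : ¬ T i j < N := fun h4 => h2 (hmemν.2 ((mem_tableaux_lt_iff hTm).1 ⟨h1, h4⟩))
      omega
    · rw [T.zeros h1]
  · intro T hT
    ext i j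
    change (if (i, j) ∈ ν then (if (i, j) ∈ μ then
      (if (i, j) ∈ ν then T i j else N) else 0) else 0) = T i j
    split_ifs with h1 h2
    · rfl
    · exact absurd (hle h1) h2
    · rw [T.zeros h1]
  · intro T hT
    obtain ⟨hTm, rfl⟩ := mem_filter.1 hT
    rw [tableauWeight, prod_range_succ, mul_comm, tableauWeight, card_columnsWith]
    congr 1
    refine prod_congr rfl fun v hv => ?_
    have hv := mem_range.1 hv
    have : entryCount v (restrictTableau hle T) = entryCount v T := by
      refine congrArg card ?_
      ext ⟨i, j⟩
      simp only [mem_filter, YoungDiagram.mem_cells]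
      change ((i, j) ∈ ν ∧ (if (i, j) ∈ ν then T i j else 0) = v) ↔ _
      constructor
      · rintro ⟨h, h'⟩
        rw [if_pos h] at h'
        exact ⟨hle h, h'⟩
      · rintro ⟨h, h'⟩
        have h2 := hmemν.2 ((mem_tableaux_lt_iff hTm).1 ⟨h, by omega⟩)
        exact ⟨h2, by rw [if_pos h2]; exact h'⟩
    rw [this]

theorem sum_tableauWeight {R : Type*} [CommSemiring R] (a b : ℕ → R) (N : ℕ) :
    ∀ μ : YoungDiagram, μ.rowLen 0 ≤ N →
      ∑ T ∈ tableaux μ N, tableauWeight a b N T = columnSum a b N μ.colLen := by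
  classical
  induction N with
  | zero =>
    intro μ hμ
    have hbot : ∀ i j, (i, j) ∉ μ := by
      intro i j h
      have := YoungDiagram.mem_iff_lt_rowLen.1 (μ.up_left_mem (Nat.zero_le i) le_rfl h)
      omega
    have hset : tableaux μ 0 = {SemistandardYoungTableau.highestWeight μ} := by
      refine eq_singleton_iff_unique_mem.2 ⟨mem_tableaux.2 fun i j h => absurd h (hbot i j), ?_⟩
      intro T _
      ext i j
      rw [T.zeros (hbot i j), SemistandardYoungTableau.zeros _ (hbot i j)]
    rw [hset, sum_singleton, tableauWeight, columnSum, range_zero, prod_empty]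
  | succ N ih =>
    intro μ hμ
    rw [columnSum]
    split_ifs with hN
    · have hmaps : ∀ T ∈ tableaux μ (N + 1), columnsWith N T ∈ (range N).powerset.filter
          fun D => (∀ j ∈ D, 0 < μ.colLen j) ∧ Antitone (removeCells μ.colLen D) := fun T hT =>
        mem_filter.2 ⟨mem_powerset.2 (columnsWith_subset hT), fun _ => columnsWith_pos,
          antitone_removeCells_columnsWith hT⟩
      rw [← sum_fiberwise_of_maps_to hmaps]
      refine sum_congr rfl fun D hD => ?_
      obtain ⟨hD, hpos, hanti⟩ := mem_filter.1 hD
      have h0 : removeCells μ.colLen D N = 0 := by simp [removeCells, hN]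
      obtain ⟨ν, hν⟩ := exists_colLen_eq hanti h0
      rw [sum_tableaux_fiber a b hpos (mem_powerset.1 hD) hν, ih, hν]
      by_contra hlt
      have := YoungDiagram.mem_iff_lt_colLen.1
        (YoungDiagram.mem_iff_lt_rowLen.2 (not_le.1 hlt))
      rw [hν] at this
      omega
    · refine sum_eq_zero fun T hT => ?_
      have h : (0, N) ∈ μ := YoungDiagram.mem_iff_lt_colLen.2 (Nat.pos_of_ne_zero hN)
      have := mem_tableaux.1 hT _ _ h
      omega

/-! ### Counting tableaux -/

theorem tableaux_card_eq {R : Type*} [CommSemiring R] {μ : YoungDiagram} {N : ℕ}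
    (h : μ.rowLen 0 ≤ N) :
    ((tableaux μ N).card : R) = columnSum (fun _ => 1) (fun _ => 1) N μ.colLen := by
  rw [← sum_tableauWeight _ _ N μ h]
  simp [tableauWeight]

/-- The weights `b` which give `t` to every column without the largest entry `N - 1`. -/
noncomputable def topWeight (N : ℕ) : ℕ → Polynomial ℤ :=
  fun v => if v + 1 = N then Polynomial.X else 1

theorem topCount_le {μ : YoungDiagram} {N : ℕ} (T : SemistandardYoungTableau μ) :
    topCount N T ≤ μ.rowLen 0 := by
  have h1 : topCount N T = entryCount (N - 1) T ∨ topCount N T = 0 := by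
    rcases N with _ | N
    · right
      simp [topCount]
    · left
      simp [topCount, entryCount]
  rcases h1 with h1 | h1
  · rw [h1, ← card_columnsWith, ← card_range (μ.rowLen 0)]
    refine card_le_card fun j hj => ?_
    obtain ⟨i, h, -⟩ := mem_columnsWith.1 hj
    exact mem_range.2 (YoungDiagram.mem_iff_lt_rowLen.1 (μ.up_left_mem (Nat.zero_le i) le_rfl h))
  · omega

/-- Of the `N - 1` columns that enter the weight, `N - 1 - λ₁` are empty. -/
theorem X_pow_mul_tableauPoly {μ : YoungDiagram} {N : ℕ} (h : μ.rowLen 0 < N) :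
    Polynomial.X ^ (N - 1 - μ.rowLen 0) * tableauPoly μ N =
      columnSum (fun _ => 1) (topWeight N) N μ.colLen := by
  rw [← sum_tableauWeight _ _ N μ h.le, tableauPoly, mul_sum]
  refine sum_congr rfl fun T _ => ?_
  obtain ⟨M, rfl⟩ : ∃ M, N = M + 1 := ⟨N - 1, by omega⟩
  have hle := topCount_le (N := M + 1) T
  have hc : topCount (M + 1) T = entryCount M T := by simp [topCount, entryCount]
  rw [tableauWeight, prod_range_succ, prod_eq_one, one_mul, one_pow, one_mul, topWeight,
    if_pos rfl, ← pow_add, ← hc]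
  · congr 1
    omega
  · intro v hv
    have : v ≠ M := (mem_range.1 hv).ne
    simp [topWeight, this]

theorem colLen_eq_zero {μ : YoungDiagram} {j : ℕ} (h : μ.rowLen 0 ≤ j) : μ.colLen j = 0 := by
  by_contra hne
  have := YoungDiagram.mem_iff_lt_rowLen.1
    (YoungDiagram.mem_iff_lt_colLen.2 (Nat.pos_of_ne_zero hne))
  omega

theorem antitone_colLen (μ : YoungDiagram) : Antitone μ.colLen := fun _ _ h => μ.colLen_anti _ _ h

theorem columnSum_eq_det {R : Type*} [CommRing R] (a b : ℕ → R) {μ : YoungDiagram} {m N : ℕ}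
    (hm : μ.rowLen 0 ≤ m) (h : m ≤ N) :
    columnSum a b N μ.colLen =
      (stepMatrix a b N m fun j => (μ.colLen j : ℤ) - j).det *
        ∏ j ∈ Ico m N, ∏ u ∈ Ico (j + 1) N, b u := by
  obtain ⟨d, rfl⟩ := Nat.exists_eq_add_of_le h
  rw [← det_stepMatrix a b _ _ (antitone_colLen μ),
    det_stepMatrix_pad a b _ _ d fun _ hj => colLen_eq_zero (hm.trans hj), prod_Ico_eq_prod_range,
    Nat.add_sub_cancel_left]
  congr 1
  refine prod_congr rfl fun e _ => ?_
  rw [stepCoeff_zero, prod_Ico_eq_prod_range]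

/-! ### Binomial determinants -/

theorem binom_zero (k : ℤ) : binom 0 k = if k = 0 then 1 else 0 := by
  unfold binom
  split_ifs with h1 h2 h2
  · simp [h2]
  · have : 0 < k.toNat := by omega
    rw [Nat.choose_eq_zero_of_lt this, Nat.cast_zero]
  · omega
  · rfl

theorem binom_succ (s : ℕ) (k : ℤ) : binom (s + 1) k = binom s (k - 1) + binom s k := by
  unfold binom
  rcases lt_trichotomy k 0 with h | rfl | h
  · rw [if_neg (by omega), if_neg (by omega), if_neg (by omega), add_zero]
  · simp
  · rw [if_pos (by omega), if_pos (by omega), if_pos (by omega)]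
    obtain ⟨m, rfl⟩ : ∃ m : ℕ, k = m + 1 := ⟨(k - 1).toNat, by omega⟩
    have h1 : ((m : ℤ) + 1).toNat = m + 1 := by omega
    have h2 : ((m : ℤ) + 1 - 1).toNat = m := by omega
    rw [h1, h2, Nat.choose_succ_succ]
    push_cast
    rfl

theorem stepCoeff_eq_binom {R : Type*} [CommRing R] (a b : ℕ → R) (i s : ℕ)
    (h : ∀ u < s, a (i + 1 + u) = 1 ∧ b (i + 1 + u) = 1) :
    ∀ k, stepCoeff a b i s k = (binom s k : ℤ) := by
  induction s with
  | zero => intro k; rw [binom_zero, stepCoeff]; split_ifs <;> simp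
  | succ s ih =>
    intro k
    have ih := ih fun u hu => h u (by omega)
    rw [stepCoeff, ih, ih, (h s (by omega)).1, (h s (by omega)).2, binom_succ]
    push_cast
    ring

theorem card_tableaux_eq_binomDet {μ : YoungDiagram} {N : ℕ} (h : μ.rowLen 0 ≤ N) :
    ((tableaux μ N).card : ℤ) = binomDet μ N := by
  rw [tableaux_card_eq h, columnSum_eq_det _ _ le_rfl h]
  simp only [prod_const_one, mul_one]
  rw [binomDet]
  congr 1
  ext i j
  simp only [stepMatrix, Matrix.of_apply]
  rw [stepCoeff_eq_binom _ _ _ _ fun _ _ => ⟨rfl, rfl⟩, Int.cast_id]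

theorem prod_topWeight {m N : ℕ} (h : m < N) :
    ∏ j ∈ Ico m N, ∏ u ∈ Ico (j + 1) N, topWeight N u = Polynomial.X ^ (N - 1 - m) := by
  obtain ⟨M, rfl⟩ : ∃ M, N = M + 1 := ⟨N - 1, by omega⟩
  rw [prod_Ico_succ_top (by omega), Ico_self, prod_empty, mul_one,
    prod_congr rfl (g := fun _ => Polynomial.X), prod_const, Nat.card_Ico, Nat.add_sub_cancel]
  intro j hj
  have := mem_Ico.1 hj
  rw [prod_Ico_succ_top (by omega), prod_eq_one, one_mul, topWeight, if_pos rfl]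
  intro u hu
  have := mem_Ico.1 hu
  rw [topWeight, if_neg (by omega)]

theorem tableauPoly_eq_binomDetT {μ : YoungDiagram} {N : ℕ} (h : μ.rowLen 0 < N) :
    tableauPoly μ N = binomDetT μ N := by
  -- Both sides are compared after multiplication by the weight of the empty columns.
  have hX : (Polynomial.X ^ (N - 1 - μ.rowLen 0) : Polynomial ℤ) ≠ 0 :=
    pow_ne_zero _ Polynomial.X_ne_zero
  refine mul_left_cancel₀ hX ?_
  rw [X_pow_mul_tableauPoly h, columnSum_eq_det _ _ le_rfl h.le, prod_topWeight h, mul_comm,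
    binomDetT]
  congr 2
  ext1 i j
  have hi : N - (i + 1) = (N - (i + 1) - 1) + 1 := by have := i.2; omega
  simp only [stepMatrix, Matrix.of_apply]
  rw [hi, stepCoeff, Nat.add_sub_cancel]
  have hone : ∀ u < N - (i + 1) - 1,
      (1 : Polynomial ℤ) = 1 ∧ topWeight N (i + 1 + u) = 1 := fun u hu =>
    ⟨rfl, by rw [topWeight, if_neg (by omega)]⟩
  rw [stepCoeff_eq_binom _ _ _ _ hone, stepCoeff_eq_binom _ _ _ _ hone, topWeight,
    if_pos (by have := i.2; omega), one_mul]
  simp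

/-! ### Elementary symmetric polynomials and column multi-Schur polynomials -/

/-- The elementary symmetric polynomial `e_k` in the variables `x_a`, `a ∈ A`. -/
noncomputable def elemSymmOn (A : Finset ℕ) (k : ℤ) : MvPolynomial ℕ ℤ :=
  if 0 ≤ k then ∑ S ∈ A.powersetCard k.toNat, ∏ a ∈ S, MvPolynomial.X a else 0

theorem elemSymmOn_neg (A : Finset ℕ) {k : ℤ} (h : k < 0) : elemSymmOn A k = 0 :=
  if_neg (by omega)

theorem elemSymmOn_zero (A : Finset ℕ) : elemSymmOn A 0 = 1 := by simp [elemSymmOn]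

theorem elemSymmOn_gt (A : Finset ℕ) {k : ℤ} (h : (A.card : ℤ) < k) : elemSymmOn A k = 0 := by
  rw [elemSymmOn, if_pos (by omega), powersetCard_eq_empty.2 (by omega), sum_empty]

theorem elemSymmOn_card (A : Finset ℕ) : elemSymmOn A A.card = ∏ a ∈ A, MvPolynomial.X a := by
  simp [elemSymmOn]

theorem elemSymmOn_empty (k : ℤ) : elemSymmOn ∅ k = if k = 0 then 1 else 0 := by
  rcases lt_trichotomy k 0 with h | rfl | h
  · rw [elemSymmOn_neg _ h, if_neg h.ne]
  · rw [elemSymmOn_zero, if_pos rfl]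
  · rw [elemSymmOn_gt _ (by simpa using h), if_neg h.ne']

theorem elemSymmOn_insert {A : Finset ℕ} {x : ℕ} (hx : x ∉ A) (k : ℤ) :
    elemSymmOn (insert x A) k = MvPolynomial.X x * elemSymmOn A (k - 1) + elemSymmOn A k := by
  rcases lt_trichotomy k 0 with h | rfl | h
  · simp [elemSymmOn_neg _ h, elemSymmOn_neg A (show k - 1 < 0 by omega)]
  · simp [elemSymmOn_zero, elemSymmOn_neg]
  · obtain ⟨m, rfl⟩ : ∃ m : ℕ, k = m + 1 := ⟨(k - 1).toNat, by omega⟩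
    have h1 : ((m : ℤ) + 1).toNat = m + 1 := by omega
    have h2 : ((m : ℤ) + 1 - 1).toNat = m := by omega
    rw [elemSymmOn, elemSymmOn, elemSymmOn, if_pos (by omega), if_pos (by omega),
      if_pos (by omega), h1, h2, powersetCard_succ_insert hx, sum_union, add_comm]
    · congr 1
      rw [sum_image, mul_sum]
      · refine sum_congr rfl fun S hS => prod_insert fun h => hx ((mem_powersetCard.1 hS).1 h)
      · intro S hS S' hS' h
        have hxS : ∀ U ∈ powersetCard m A, x ∉ U := fun U hU h => hx ((mem_powersetCard.1 hU).1 h)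
        rw [← erase_insert (hxS S hS), h, erase_insert (hxS S' hS')]
    · rw [disjoint_left]
      intro S hS hS'
      obtain ⟨S', -, rfl⟩ := mem_image.1 hS'
      exact hx ((mem_powersetCard.1 hS).1 (mem_insert_self _ _))

theorem elemSymm_eq (m : ℕ) (k : ℤ) : elemSymm m k = elemSymmOn (Icc 1 m) k := rfl

theorem elemSymm_succ (m : ℕ) (k : ℤ) :
    elemSymm (m + 1) k = MvPolynomial.X (m + 1) * elemSymm m (k - 1) + elemSymm m k := by
  rw [elemSymm_eq, elemSymm_eq, elemSymm_eq, ← insert_Icc_right_eq_Icc_add_one (by omega),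
    elemSymmOn_insert (by simp)]

theorem eval_one_elemSymm (m : ℕ) (k : ℤ) :
    MvPolynomial.eval (fun _ => (1 : ℤ)) (elemSymm m k) = binom m k := by
  rw [elemSymm, binom]
  split_ifs <;> simp

/-- With the weight `x_{N-v}` in step `v`, the steps `i + 1, …, i + s` involve the variables
`x_{N-i-1}, …, x_{N-i-s}`; for `s = N - i - 1` these are all the variables in `X_{N-i-1}`. -/
theorem stepCoeff_eq_elemSymmOn (N i s : ℕ) (h : i + 1 + s ≤ N) :
    ∀ k, stepCoeff (fun v => MvPolynomial.X (N - v)) (fun _ => 1) i s k =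
      elemSymmOn (Ioc (N - (i + 1) - s) (N - (i + 1))) k := by
  induction s with
  | zero =>
    intro k
    rw [stepCoeff, Nat.sub_zero, Ioc_self, elemSymmOn_empty]
  | succ s ih =>
    intro k
    have hI : Ioc (N - (i + 1) - (s + 1)) (N - (i + 1)) =
        insert (N - (i + 1 + s)) (Ioc (N - (i + 1) - s) (N - (i + 1))) := by
      ext x
      simp only [mem_Ioc, mem_insert]
      omega
    have hnot : N - (i + 1 + s) ∉ Ioc (N - (i + 1) - s) (N - (i + 1)) := by
      simp only [mem_Ioc]
      omega
    rw [stepCoeff, ih (by omega), ih (by omega), hI, elemSymmOn_insert hnot, one_mul]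

theorem stepMatrix_eq_elemSymm {m N : ℕ} (h : m ≤ N) (c : ℕ → ℤ) :
    stepMatrix (fun v => MvPolynomial.X (N - v)) (fun _ => 1) N m c =
      Matrix.of fun i j : Fin m => elemSymm (N - (i + 1)) (c j + i) := by
  ext1 i j
  have := i.2
  simp only [stepMatrix, Matrix.of_apply]
  rw [stepCoeff_eq_elemSymmOn N i (N - (i + 1)) (by omega), Nat.sub_self]
  rfl

theorem colMultiSchur_eq_columnSum {μ : YoungDiagram} {N : ℕ} (h : μ.rowLen 0 ≤ N) :
    colMultiSchur μ N =
      columnSum (fun v => MvPolynomial.X (N - v)) (fun _ => 1) N μ.colLen := by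
  rw [columnSum_eq_det _ _ le_rfl h, stepMatrix_eq_elemSymm h]
  simp only [prod_const_one, mul_one]
  rfl

theorem colMultiSchur_eq_det {μ : YoungDiagram} {m N : ℕ} (hm : μ.rowLen 0 ≤ m) (h : m ≤ N) :
    colMultiSchur μ N =
      (Matrix.of fun i j : Fin m => elemSymm (N - (i + 1)) ((μ.colLen j : ℤ) - j + i)).det := by
  rw [colMultiSchur_eq_columnSum (hm.trans h), columnSum_eq_det _ _ hm h,
    stepMatrix_eq_elemSymm h]
  simp only [prod_const_one, mul_one]

theorem map_columnSum {R S : Type*} [CommSemiring R] [CommSemiring S] (φ : R →+* S) (a b : ℕ → R)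
    (N : ℕ) : ∀ L, φ (columnSum a b N L) = columnSum (fun v => φ (a v)) (fun v => φ (b v)) N L := by
  induction N with
  | zero => intro L; simp [columnSum]
  | succ N ih =>
    intro L
    simp only [columnSum]
    split_ifs
    · simp [map_sum, ih]
    · simp

/-- The coefficients are nonnegative because the recursion makes sense over the semiring `ℕ`. -/
theorem coeff_colMultiSchur_nonneg {μ : YoungDiagram} {N : ℕ} (h : μ.rowLen 0 ≤ N) (d : ℕ →₀ ℕ) :
    0 ≤ (colMultiSchur μ N).coeff d := by
  have h2 := map_columnSum (MvPolynomial.map (σ := ℕ) (Nat.castRingHom ℤ))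
    (fun v => MvPolynomial.X (N - v)) (fun _ => 1) N μ.colLen
  simp only [MvPolynomial.map_X, map_one] at h2
  rw [colMultiSchur_eq_columnSum h, ← h2, MvPolynomial.coeff_map]
  simp

theorem eval_one_colMultiSchur (μ : YoungDiagram) (N : ℕ) :
    MvPolynomial.eval (fun _ => (1 : ℤ)) (colMultiSchur μ N) = binomDet μ N := by
  rw [colMultiSchur, binomDet, RingHom.map_det]
  congr 1
  ext i j
  simp [eval_one_elemSymm]

theorem eval_one_colMultiSchurT {μ : YoungDiagram} {N : ℕ} (h : μ.rowLen 0 < N) :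
    (colMultiSchurT μ N).eval 1 = colMultiSchur μ N := by
  rw [← Polynomial.coe_evalRingHom, colMultiSchurT, colMultiSchur, RingHom.map_det]
  congr 1
  ext1 i j
  have hi : N - (i + 1) = (N - (i + 1) - 1) + 1 := by have := i.2; omega
  simp only [RingHom.mapMatrix_apply, Matrix.map_apply, Matrix.of_apply]
  rw [hi, elemSymm_succ, Nat.add_sub_cancel]
  simp

theorem map_eval_one_colMultiSchurT (μ : YoungDiagram) (N : ℕ) :
    (colMultiSchurT μ N).map (MvPolynomial.eval fun _ => (1 : ℤ)) = binomDetT μ N := by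
  rw [← Polynomial.coe_mapRingHom, colMultiSchurT, binomDetT, RingHom.map_det]
  congr 1
  ext1 i j
  simp [eval_one_elemSymm]
  exact mul_comm _ _

/-! ### Nonintersecting lattice paths -/

theorem columnSum_congr {R : Type*} [CommSemiring R] {a b a' b' : ℕ → R} (N : ℕ)
    (h : ∀ v < N, a v = a' v ∧ b v = b' v) : ∀ L, columnSum a b N L = columnSum a' b' N L := by
  induction N with
  | zero => intro L; simp [columnSum]
  | succ N ih =>
    intro L
    simp only [columnSum, ih fun v hv => h v (by omega), h N (by omega)]

/-- In all steps but the last, the weights `topWeight` are `1`. -/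
theorem C_eval_one_columnSum (N : ℕ) (L : ℕ → ℕ) :
    Polynomial.C ((columnSum (fun _ => 1) (topWeight N) N L).eval 1) =
      columnSum (fun _ => 1) (topWeight (N + 1)) N L := by
  rw [← Polynomial.coe_evalRingHom, map_columnSum, map_columnSum]
  refine columnSum_congr _ (fun v hv => ⟨by simp, ?_⟩) _
  rw [topWeight, topWeight, if_neg (show v + 1 ≠ N + 1 by omega)]
  split_ifs <;> simp

/-- The condition in the recursion of `pathPoly`, in terms of column lengths: the first point is `1`
exactly if the last column is emptied, and the points increase strictly exactly if the new column
lengths decrease weakly. -/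
theorem path_condition_iff {m : ℕ} {L : ℕ → ℕ} (hL : Antitone L) (hm : L (m + 1) = 0)
    {D : Finset ℕ} (hD : D ⊆ range (m + 1)) {q : Fin (m + 1) → ℤ}
    (hq : ∀ i, q i = (L (m - i) : ℤ) + (i + 1) - if m - (i : ℕ) ∈ D then 1 else 0) :
    (q 0 = 1 ∧ StrictMono q) ↔
      ((∀ j ∈ D, 0 < L j) ∧ Antitone (removeCells L D)) ∧ removeCells L D m = 0 := by
  have hq0 : q 0 = (L m : ℤ) + 1 - if m ∈ D then 1 else 0 := by simpa using hq 0
  constructor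
  · rintro ⟨h0, hmono⟩
    have hlow : ∀ k (hk : k < m + 1), (k : ℤ) + 1 ≤ q ⟨k, hk⟩ := by
      intro k
      induction k with
      | zero => exact fun _ => h0.symm.le.trans' (by simp)
      | succ k ih =>
        intro hk
        have h1 := ih (by omega)
        have h2 : q ⟨k, by omega⟩ < q ⟨k + 1, hk⟩ := hmono (Fin.mk_lt_mk.2 (Nat.lt_succ_self k))
        push_cast
        omega
    refine ⟨⟨fun j hj => ?_, antitone_nat_of_succ_le fun j => ?_⟩, ?_⟩
    · have hjm := mem_range.1 (hD hj)
      have h1 := hlow (m - j) (by omega)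
      rw [hq] at h1
      simp only [show m - (m - j) = j by omega, if_pos hj] at h1
      omega
    · simp only [removeCells]
      by_cases hj : j < m
      · have h1 : q ⟨m - (j + 1), by omega⟩ < q ⟨m - j, by omega⟩ :=
          hmono (Fin.mk_lt_mk.2 (by omega))
        have h2 := hlow (m - (j + 1)) (by omega)
        rw [hq] at h1 h2
        rw [hq] at h1
        simp only [show m - (m - j) = j by omega, show m - (m - (j + 1)) = j + 1 by omega] at h1 h2
        split_ifs at * <;> omega
      · have := hL (show m + 1 ≤ j + 1 by omega)
        omega
    · rw [h0] at hq0
      simp only [removeCells]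
      split_ifs at hq0 ⊢ <;> omega
  · rintro ⟨⟨hpos, hanti⟩, h0⟩
    have hcast : ∀ j, (removeCells L D j : ℤ) = L j - if j ∈ D then 1 else 0 := by
      intro j
      simp only [removeCells]
      split_ifs with h
      · have := hpos j h
        omega
      · simp
    have hq' : ∀ i, q i = (removeCells L D (m - i) : ℤ) + (i + 1) := by
      intro i
      rw [hq, hcast]
      ring
    refine ⟨by rw [hq']; simp [h0], Fin.strictMono_iff_lt_succ.2 fun i => ?_⟩
    have := hanti (show m - (i.succ : ℕ) ≤ m - (i.castSucc : ℕ) by simp; omega)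
    rw [hq', hq']
    simp only [Fin.val_succ, Fin.val_castSucc] at this ⊢
    push_cast
    omega

/-- Column `j` of the tableau corresponds to the path with number `m - 1 - j`. -/
theorem pathPoly_eq_columnSum (m : ℕ) : ∀ L : ℕ → ℕ, Antitone L → L m = 0 →
    pathPoly m (fun i => (L (m - (i + 1)) : ℤ) + (i + 1)) =
      columnSum (fun _ => 1) (topWeight (m + 1)) (m + 1) L := by
  classical
  induction m with
  | zero =>
    intro L hL hm
    rw [columnSum, if_pos hm, range_zero, powerset_empty, filter_true_of_mem, sum_singleton]
    · simp [columnSum, pathPoly]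
    · intro D hD
      have h : removeCells L ∅ = L := by ext; simp [removeCells]
      rw [mem_singleton.1 hD, h]
      exact ⟨by simp, hL⟩
  | succ m ih =>
    intro L hL hm
    rw [columnSum, if_pos hm, pathPoly, sum_filter]
    have hrev : Function.Injective fun i : Fin (m + 1) => m - (i : ℕ) := by
      intro i j h
      have := i.2
      have := j.2
      simp only at h
      exact Fin.ext (by omega)
    refine sum_nbij (fun s => s.map ⟨_, hrev⟩) ?_ ?_ ?_ ?_
    · intro s _
      rw [mem_powerset]
      intro x hx
      obtain ⟨y, -, rfl⟩ := mem_map.1 hx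
      simp only [Function.Embedding.coeFn_mk, mem_range]
      omega
    · exact fun s _ t _ h => map_injective _ h
    · intro D hD
      have hD' := mem_powerset.1 (mem_coe.1 hD)
      refine ⟨univ.filter fun i => m - (i : ℕ) ∈ D, by simp, ?_⟩
      ext x
      simp only [mem_map, mem_filter, mem_univ, true_and, Function.Embedding.coeFn_mk]
      constructor
      · rintro ⟨i, hi, rfl⟩; exact hi
      · intro hx
        have := mem_range.1 (hD' hx)
        have h2 : m - (m - x) = x := by omega
        exact ⟨⟨m - x, by omega⟩, by simpa only [h2] using hx, h2⟩
    · intro s _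
      rw [card_map]
      set D := s.map ⟨_, hrev⟩ with hDdef
      have hD : D ⊆ range (m + 1) := by
        intro x hx
        obtain ⟨y, -, rfl⟩ := mem_map.1 hx
        simp only [Function.Embedding.coeFn_mk, mem_range]
        omega
      have hmem : ∀ i : Fin (m + 1), i ∈ s ↔ m - (i : ℕ) ∈ D := fun i =>
        (mem_map' (⟨_, hrev⟩ : Fin (m + 1) ↪ ℕ)).symm
      have hiff := path_condition_iff hL hm hD
        (q := fun i => (L (m + 1 - (i + 1)) : ℤ) + (i + 1) - if i ∈ s then 1 else 0) (fun i => by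
          simp only [hmem, Nat.add_sub_add_right])
      simp only [hiff, card_compl, Fintype.card_fin, one_pow, one_mul]
      have htop : topWeight (m + 1 + 1) (m + 1) = Polynomial.X := if_pos rfl
      rw [htop]
      by_cases hv : (∀ j ∈ D, 0 < L j) ∧ Antitone (removeCells L D)
      · rw [if_pos hv]
        by_cases h0 : removeCells L D m = 0
        · rw [if_pos ⟨hv, h0⟩, ← C_eval_one_columnSum, ← ih _ hv.2 h0]
          congr 5
          ext i
          have h3 : m + 1 - ((i.succ : ℕ) + 1) = m - (i + 1) := by simp
          simp only [hmem, removeCells, Fin.val_succ, Nat.add_sub_add_right]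
          split_ifs with hi
          · have := hv.1 _ hi
            push_cast
            omega
          · push_cast
            omega
        · rw [if_neg fun h => h0 h.2, columnSum, if_neg h0, mul_zero]
      · rw [if_neg fun h => hv h.1, if_neg hv]

theorem add_lt_of_le_staircase {n : ℕ} {μ : YoungDiagram} (hμ : μ ≤ staircase n) {i j : ℕ}
    (h : (i, j) ∈ μ) : i + j + 2 ≤ n := by
  have h2 := hμ h
  rw [← YoungDiagram.mem_cells] at h2
  exact (mem_filter.1 h2).2

theorem rowLen_le_of_le_staircase {n : ℕ} {μ : YoungDiagram} (hμ : μ ≤ staircase n) (i : ℕ) :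
    μ.rowLen i ≤ n - 1 - i := by
  by_contra h
  have := add_lt_of_le_staircase hμ (YoungDiagram.mem_iff_lt_rowLen.2 (not_le.1 h))
  omega

theorem pathPoly_endPoints {n : ℕ} {μ : YoungDiagram} (hn : 1 ≤ n) (hμ : μ ≤ staircase n) :
    pathPoly (n - 1) (endPoints n μ) =
      Polynomial.X ^ (n - 1 - μ.rowLen 0) * tableauPoly μ n := by
  have h2 := rowLen_le_of_le_staircase hμ 0
  rw [X_pow_mul_tableauPoly (by omega)]
  have h := pathPoly_eq_columnSum (n - 1) μ.colLen (antitone_colLen μ)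
    (colLen_eq_zero (by omega))
  rw [Nat.sub_add_cancel hn] at h
  exact h

/-! ### Totally symmetric self-complementary plane partitions -/

theorem mem_iff_lt_card {A : Finset ℕ} (hA : ∀ k ∈ A, ∀ l ≤ k, l ∈ A) (k : ℕ) :
    k ∈ A ↔ k < A.card := by
  constructor
  · intro hk
    have h : range (k + 1) ⊆ A := fun l hl => hA k hk l (by have := mem_range.1 hl; omega)
    have := card_le_card h
    rw [card_range] at this
    omega
  · intro hk
    by_contra hk'
    have h : A ⊆ range k := fun l hl => by
      by_contra hl'
      exact hk' (hA l hl k (by have := mem_range.not.1 hl'; omega))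
    have := card_le_card h
    rw [card_range] at this
    omega

namespace IsTSSCPP

variable {n : ℕ} {P : Finset (ℕ × ℕ × ℕ)}

theorem mem_of_le (h : IsTSSCPP n P) {i j k i' j' k' : ℕ} (hm : (i, j, k) ∈ P) (hi : i' ≤ i)
    (hj : j' ≤ j) (hk : k' ≤ k) : (i', j', k') ∈ P :=
  h.2.1 _ hm _ ⟨hi, hj, hk⟩

theorem swap_left (h : IsTSSCPP n P) {i j k : ℕ} : (i, j, k) ∈ P ↔ (j, i, k) ∈ P :=
  ⟨fun hm => (h.2.2.1 _ _ _ hm).1, fun hm => (h.2.2.1 _ _ _ hm).1⟩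

theorem swap_right (h : IsTSSCPP n P) {i j k : ℕ} : (i, j, k) ∈ P ↔ (i, k, j) ∈ P :=
  ⟨fun hm => (h.2.2.1 _ _ _ hm).2, fun hm => (h.2.2.1 _ _ _ hm).2⟩

theorem swap_outer (h : IsTSSCPP n P) {i j k : ℕ} : (i, j, k) ∈ P ↔ (k, j, i) ∈ P := by
  rw [h.swap_left, h.swap_right, h.swap_left]

theorem mem_iff_lt_ppHeight (h : IsTSSCPP n P) {i j k : ℕ} :
    (i, j, k) ∈ P ↔ k < ppHeight P i j := by
  have hmem : ∀ k, (i, j, k) ∈ P ↔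
      k ∈ (P.filter fun c => c.1 = i ∧ c.2.1 = j).image fun c => c.2.2 := by
    intro k
    simp only [mem_image, mem_filter, Prod.exists]
    exact ⟨fun hk => ⟨i, j, k, ⟨hk, rfl, rfl⟩, rfl⟩,
      by rintro ⟨_, _, _, ⟨hk, rfl, rfl⟩, rfl⟩; exact hk⟩
  have hcard : ((P.filter fun c => c.1 = i ∧ c.2.1 = j).image fun c => c.2.2).card =
      ppHeight P i j := by
    refine card_image_of_injOn ?_
    rintro ⟨a, b, c⟩ h1 ⟨a', b', c'⟩ h2 rfl
    simp only [coe_filter, Set.mem_ofPred_eq] at h1 h2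
    obtain ⟨-, rfl, rfl⟩ := h1
    obtain ⟨-, rfl, rfl⟩ := h2
    rfl
  rw [hmem, ← hcard]
  refine mem_iff_lt_card (fun k hk l hl => ?_) k
  rw [← hmem] at hk ⊢
  exact h.mem_of_le hk le_rfl le_rfl hl

/-- It suffices to consider the cube `(i, n - 1, 2n - 1 - i)`. If it were missing, its complement
would be in `P`, which up to the order of coordinates is `(i, n, 2n - 1 - i)` and lies above it. -/
theorem mem_of_add_le (h : IsTSSCPP n P) {i j k : ℕ} (hj : j < n) (hk : i + k + 1 ≤ 2 * n) :
    (i, j, k) ∈ P := by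
  have hbig : (i, n - 1, 2 * n - 1 - i) ∈ P := by
    by_contra hnot
    have h1 := not_not.1 ((h.2.2.2 i (n - 1) (2 * n - 1 - i) (by omega) (by omega)
      (by omega)).not.1 hnot)
    rw [show 2 * n - 1 - (n - 1) = n by omega, show 2 * n - 1 - (2 * n - 1 - i) = i by omega,
      h.swap_outer] at h1
    exact hnot (h.mem_of_le h1 le_rfl (by omega) le_rfl)
  exact h.mem_of_le hbig le_rfl (by omega) (by omega)

theorem mem_of_lt (h : IsTSSCPP n P) {i j k : ℕ} (hi : i < n) (hj : j < n) (hk : k < n) :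
    (i, j, k) ∈ P :=
  h.mem_of_add_le hj (by omega)

/-- After sorting its coordinates, a cube with none or one of them at least `n` is in `P`
unconditionally or by assumption; the others are complements of such cubes. -/
theorem subset_of_forall_mem {P' : Finset (ℕ × ℕ × ℕ)} (h : IsTSSCPP n P) (h' : IsTSSCPP n P')
    (hPP : ∀ i j k, i ≤ j → j < n → n ≤ k → k < 2 * n → ((i, j, k) ∈ P ↔ (i, j, k) ∈ P')) :
    P ⊆ P' := by
  have hsorted : ∀ i j k, i ≤ j → j ≤ k → (i, j, k) ∈ P → (i, j, k) ∈ P' := by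
    intro i j k hij hjk hm
    have hk := (h.1 _ hm).2.2
    simp only at hk
    by_cases h1 : k < n
    · exact h'.mem_of_lt (by omega) (by omega) h1
    by_cases h2 : j < n
    · exact (hPP i j k hij h2 (by omega) hk).1 hm
    have hcompl := (h.2.2.2 i j k (by omega) (by omega) hk).1 hm
    by_cases h3 : i < n
    · rw [h'.2.2.2 i j k (by omega) (by omega) hk]
      intro hm'
      refine hcompl ?_
      rw [h.swap_outer, hPP _ _ _ (by omega) (by omega) (by omega) (by omega), h'.swap_outer]
      exact hm'
    · exact absurd (h.mem_of_lt (by omega) (by omega) (by omega)) hcompl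
  rintro ⟨i, j, k⟩ hm
  rcases le_total i j with h1 | h1 <;> rcases le_total j k with h2 | h2 <;>
    rcases le_total i k with h3 | h3
  · exact hsorted _ _ _ h1 h2 hm
  · exact hsorted _ _ _ h1 h2 hm
  · exact h'.swap_right.1 (hsorted _ _ _ h3 h2 (h.swap_right.1 hm))
  · exact h'.swap_right.1 (h'.swap_left.1 (hsorted _ _ _ h3 h1 (h.swap_left.1 (h.swap_right.1 hm))))
  · exact h'.swap_left.1 (hsorted _ _ _ h1 h3 (h.swap_left.1 hm))
  · exact h'.swap_left.1 (h'.swap_right.1 (hsorted _ _ _ h2 h3 (h.swap_right.1 (h.swap_left.1 hm))))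
  · exact h'.swap_outer.1 (hsorted _ _ _ h2 h1 (h.swap_outer.1 hm))
  · exact h'.swap_outer.1 (hsorted _ _ _ h2 h1 (h.swap_outer.1 hm))

theorem eq_of_forall_mem {P' : Finset (ℕ × ℕ × ℕ)} (h : IsTSSCPP n P) (h' : IsTSSCPP n P')
    (hPP : ∀ i j k, i ≤ j → j < n → n ≤ k → k < 2 * n → ((i, j, k) ∈ P ↔ (i, j, k) ∈ P')) :
    P = P' :=
  (h.subset_of_forall_mem h' hPP).antisymm
    (h'.subset_of_forall_mem h fun i j k h1 h2 h3 h4 => (hPP i j k h1 h2 h3 h4).symm)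

end IsTSSCPP

/-- Membership of a cube in the plane partition determined by a relation `B`, symmetric in its first
two arguments, where `B i j c` says that the cube `(i, j, 2n - 1 - c)` is missing (`i, j, c < n`).
The disjuncts list which coordinates are at least `n`; if two are, the complementary cube
decides. -/
def BoxMem (n : ℕ) (B : ℕ → ℕ → ℕ → Prop) (i j k : ℕ) : Prop :=
  (i < n ∧ j < n ∧ k < n) ∨
  (i < n ∧ j < n ∧ n ≤ k ∧ ¬ B i j (2 * n - 1 - k)) ∨
  (i < n ∧ n ≤ j ∧ k < n ∧ ¬ B i k (2 * n - 1 - j)) ∨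
  (n ≤ i ∧ j < n ∧ k < n ∧ ¬ B j k (2 * n - 1 - i)) ∨
  (i < n ∧ n ≤ j ∧ n ≤ k ∧ B (2 * n - 1 - j) (2 * n - 1 - k) i) ∨
  (n ≤ i ∧ j < n ∧ n ≤ k ∧ B (2 * n - 1 - i) (2 * n - 1 - k) j) ∨
  (n ≤ i ∧ n ≤ j ∧ k < n ∧ B (2 * n - 1 - i) (2 * n - 1 - j) k)

open Classical in
/-- The set of cubes of side `2n` described by `BoxMem`. -/
noncomputable def boxPartition (n : ℕ) (B : ℕ → ℕ → ℕ → Prop) : Finset (ℕ × ℕ × ℕ) :=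
  (range (2 * n) ×ˢ range (2 * n) ×ˢ range (2 * n)).filter fun c => BoxMem n B c.1 c.2.1 c.2.2

theorem mem_boxPartition {n : ℕ} {B : ℕ → ℕ → ℕ → Prop} {i j k : ℕ} :
    (i, j, k) ∈ boxPartition n B ↔ (i < 2 * n ∧ j < 2 * n ∧ k < 2 * n) ∧ BoxMem n B i j k := by
  simp [boxPartition]

theorem BoxMem.swap_left {n : ℕ} {B : ℕ → ℕ → ℕ → Prop} (hsymm : ∀ i j c, B i j c ↔ B j i c)
    {i j k : ℕ} (h : BoxMem n B i j k) : BoxMem n B j i k := by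
  unfold BoxMem at *
  rcases h with ⟨h1, h2, h3⟩ | ⟨h1, h2, h3, h4⟩ | ⟨h1, h2, h3, h4⟩ | ⟨h1, h2, h3, h4⟩ |
    ⟨h1, h2, h3, h4⟩ | ⟨h1, h2, h3, h4⟩ | ⟨h1, h2, h3, h4⟩
  · exact Or.inl ⟨h2, h1, h3⟩
  · exact Or.inr (Or.inl ⟨h2, h1, h3, (hsymm _ _ _).not.1 h4⟩)
  · exact Or.inr (Or.inr (Or.inr (Or.inl ⟨h2, h1, h3, h4⟩)))
  · exact Or.inr (Or.inr (Or.inl ⟨h2, h1, h3, h4⟩))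
  · exact Or.inr (Or.inr (Or.inr (Or.inr (Or.inr (Or.inl ⟨h2, h1, h3, h4⟩)))))
  · exact Or.inr (Or.inr (Or.inr (Or.inr (Or.inl ⟨h2, h1, h3, h4⟩))))
  · exact Or.inr (Or.inr (Or.inr (Or.inr (Or.inr (Or.inr ⟨h2, h1, h3, (hsymm _ _ _).1 h4⟩)))))

theorem BoxMem.swap_right {n : ℕ} {B : ℕ → ℕ → ℕ → Prop} (hsymm : ∀ i j c, B i j c ↔ B j i c)
    {i j k : ℕ} (h : BoxMem n B i j k) : BoxMem n B i k j := by
  unfold BoxMem at *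
  rcases h with ⟨h1, h2, h3⟩ | ⟨h1, h2, h3, h4⟩ | ⟨h1, h2, h3, h4⟩ | ⟨h1, h2, h3, h4⟩ |
    ⟨h1, h2, h3, h4⟩ | ⟨h1, h2, h3, h4⟩ | ⟨h1, h2, h3, h4⟩
  · exact Or.inl ⟨h1, h3, h2⟩
  · exact Or.inr (Or.inr (Or.inl ⟨h1, h3, h2, h4⟩))
  · exact Or.inr (Or.inl ⟨h1, h3, h2, h4⟩)
  · exact Or.inr (Or.inr (Or.inr (Or.inl ⟨h1, h3, h2, (hsymm _ _ _).not.1 h4⟩)))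
  · exact Or.inr (Or.inr (Or.inr (Or.inr (Or.inl ⟨h1, h3, h2, (hsymm _ _ _).1 h4⟩))))
  · exact Or.inr (Or.inr (Or.inr (Or.inr (Or.inr (Or.inr ⟨h1, h3, h2, h4⟩)))))
  · exact Or.inr (Or.inr (Or.inr (Or.inr (Or.inr (Or.inl ⟨h1, h3, h2, h4⟩)))))

/-- Only a step from `n` to `n - 1` compares values of `B` at unrelated places. There the bounds
`c < i` and `c < j` exclude that both `B (n - 1) b j` and `B (n - 1) j b` hold. -/
theorem BoxMem.of_succ {n : ℕ} {B : ℕ → ℕ → ℕ → Prop}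
    (hmono : ∀ i j c i' j' c', i ≤ i' → j ≤ j' → i' < n → j' < n → c' ≤ c → B i j c → B i' j' c')
    (hbound : ∀ i j c, i < n → j < n → B i j c → c < i ∧ c < j)
    {i j k : ℕ} (hj : j < 2 * n) (hk : k < 2 * n)
    (h : BoxMem n B (i + 1) j k) : BoxMem n B i j k := by
  unfold BoxMem at *
  rcases h with h | ⟨h1, h2, h3, h4⟩ | ⟨h1, h2, h3, h4⟩ | ⟨h1, h2, h3, h4⟩ | ⟨h1, h2, h3, h4⟩ |
    ⟨h1, h2, h3, h4⟩ | ⟨h1, h2, h3, h4⟩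
  · exact Or.inl (by omega)
  · refine Or.inr (Or.inl ⟨by omega, h2, h3, fun hB => h4 ?_⟩)
    exact hmono _ _ _ _ _ _ (by omega) le_rfl h1 h2 le_rfl hB
  · refine Or.inr (Or.inr (Or.inl ⟨by omega, h2, h3, fun hB => h4 ?_⟩))
    exact hmono _ _ _ _ _ _ (by omega) le_rfl h1 h3 le_rfl hB
  · by_cases hi : i < n
    · exact Or.inl ⟨hi, h2, h3⟩
    · refine Or.inr (Or.inr (Or.inr (Or.inl ⟨by omega, h2, h3, fun hB => h4 ?_⟩)))
      exact hmono _ _ _ _ _ _ le_rfl le_rfl h2 h3 (by omega) hB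
  · refine Or.inr (Or.inr (Or.inr (Or.inr (Or.inl ⟨by omega, h2, h3, ?_⟩))))
    exact hmono _ _ _ _ _ _ le_rfl le_rfl (by omega) (by omega) (by omega) h4
  · have hb := hbound _ _ _ (by omega) (by omega) h4
    -- For `i < n` the coordinate crosses the middle of the box, from `n` to `n - 1`.
    by_cases hi : i < n
    · refine Or.inr (Or.inl ⟨hi, h2, h3, fun hB => ?_⟩)
      have hb' := hbound _ _ _ hi h2 hB
      omega
    · refine Or.inr (Or.inr (Or.inr (Or.inr (Or.inr (Or.inl ⟨by omega, h2, h3, ?_⟩)))))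
      exact hmono _ _ _ _ _ _ (by omega) le_rfl (by omega) (by omega) le_rfl h4
  · have hb := hbound _ _ _ (by omega) (by omega) h4
    by_cases hi : i < n
    · refine Or.inr (Or.inr (Or.inl ⟨hi, h2, h3, fun hB => ?_⟩))
      have hb' := hbound _ _ _ hi h3 hB
      omega
    · refine Or.inr (Or.inr (Or.inr (Or.inr (Or.inr (Or.inr ⟨by omega, h2, h3, ?_⟩)))))
      exact hmono _ _ _ _ _ _ (by omega) le_rfl (by omega) (by omega) le_rfl h4

theorem boxMem_compl {n : ℕ} {B : ℕ → ℕ → ℕ → Prop} {i j k : ℕ} (hi : i < 2 * n) (hj : j < 2 * n)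
    (hk : k < 2 * n) :
    BoxMem n B i j k ↔ ¬ BoxMem n B (2 * n - 1 - i) (2 * n - 1 - j) (2 * n - 1 - k) := by
  have hsub : ∀ x, x < 2 * n → 2 * n - 1 - (2 * n - 1 - x) = x ∧ (2 * n - 1 - x < n ↔ n ≤ x) ∧
      (n ≤ 2 * n - 1 - x ↔ x < n) ∧ (n ≤ x ↔ ¬ x < n) := by
    intro x hx
    omega
  obtain ⟨hi1, hi2, hi3, hi4⟩ := hsub i hi
  obtain ⟨hj1, hj2, hj3, hj4⟩ := hsub j hj
  obtain ⟨hk1, hk2, hk3, hk4⟩ := hsub k hk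
  unfold BoxMem
  simp only [hi1, hj1, hk1, hi2, hj2, hk2, hi3, hj3, hk3]
  simp only [hi4, hj4, hk4]
  by_cases h1 : i < n <;> by_cases h2 : j < n <;> by_cases h3 : k < n <;> simp [h1, h2, h3]

theorem isTSSCPP_boxPartition {n : ℕ} {B : ℕ → ℕ → ℕ → Prop}
    (hsymm : ∀ i j c, B i j c ↔ B j i c)
    (hmono : ∀ i j c i' j' c', i ≤ i' → j ≤ j' → i' < n → j' < n → c' ≤ c → B i j c → B i' j' c')
    (hbound : ∀ i j c, i < n → j < n → B i j c → c < i ∧ c < j) :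
    IsTSSCPP n (boxPartition n B) := by
  have hleft : ∀ i j k, (i, j, k) ∈ boxPartition n B → (j, i, k) ∈ boxPartition n B := by
    intro i j k h
    obtain ⟨h1, h2⟩ := mem_boxPartition.1 h
    exact mem_boxPartition.2 ⟨⟨h1.2.1, h1.1, h1.2.2⟩, h2.swap_left hsymm⟩
  have hright : ∀ i j k, (i, j, k) ∈ boxPartition n B → (i, k, j) ∈ boxPartition n B := by
    intro i j k h
    obtain ⟨h1, h2⟩ := mem_boxPartition.1 h
    exact mem_boxPartition.2 ⟨⟨h1.1, h1.2.2, h1.2.1⟩, h2.swap_right hsymm⟩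
  have hdown : ∀ d i j k, (i + d, j, k) ∈ boxPartition n B → (i, j, k) ∈ boxPartition n B := by
    intro d
    induction d with
    | zero => exact fun _ _ _ h => h
    | succ d ih =>
      intro i j k h
      obtain ⟨h1, h2⟩ := mem_boxPartition.1 h
      exact ih i j k (mem_boxPartition.2 ⟨⟨by omega, h1.2⟩,
        h2.of_succ hmono hbound h1.2.1 h1.2.2⟩)
  refine ⟨fun ⟨i, j, k⟩ h => (mem_boxPartition.1 h).1, ?_,
    fun i j k h => ⟨hleft _ _ _ h, hright _ _ _ h⟩, fun i j k hi hj hk => ?_⟩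
  · rintro ⟨i, j, k⟩ h ⟨i', j', k'⟩ ⟨h1, h2, h3⟩
    simp only at h1 h2 h3
    have e1 := hdown (i - i') i' j k (by rwa [show i' + (i - i') = i by omega])
    have e2 := hdown (j - j') j' i' k (by
      rw [show j' + (j - j') = j by omega]; exact hleft _ _ _ e1)
    have e3 := hdown (k - k') k' i' j' (by
      rw [show k' + (k - k') = k by omega]; exact hleft _ _ _ (hright _ _ _ (hleft _ _ _ e2)))
    exact hright _ _ _ (hleft _ _ _ e3)
  · have hi' : 2 * n - 1 - i < 2 * n := by omega
    have hj' : 2 * n - 1 - j < 2 * n := by omega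
    have hk' : 2 * n - 1 - k < 2 * n := by omega
    rw [mem_boxPartition, mem_boxPartition, and_iff_right ⟨hi, hj, hk⟩,
      and_iff_right ⟨hi', hj', hk'⟩]
    exact boxMem_compl hi hj hk

/-! ### Plane partitions and tableaux -/

/-- The plane partition `P` and the tableau `T` have the same Gelfand–Tsetlin pattern: the number of
cubes missing from the column of `P` over `(v - r, n - 1 - r)` is the number of entries at most `v`
in row `r` of `T`. This is expressed cell by cell; cell `(r, c)` corresponds to height
`2n - 1 - c`. -/
def Corresponds (n : ℕ) {μ : YoungDiagram} (P : Finset (ℕ × ℕ × ℕ))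
    (T : SemistandardYoungTableau μ) : Prop :=
  ∀ r v c, r ≤ v → v < n → c < n →
    ((v - r, n - 1 - r, 2 * n - 1 - c) ∉ P ↔ (r, c) ∈ μ ∧ T r c ≤ v)

theorem mem_refinedTSSCPP {n : ℕ} {μ : YoungDiagram} {P : Finset (ℕ × ℕ × ℕ)} :
    P ∈ refinedTSSCPP n μ ↔
      IsTSSCPP n P ∧ ∀ i < n, ppHeight P i i + μ.rowLen (n - 1 - i) = 2 * n := by
  classical
  rw [refinedTSSCPP, mem_filter, tsscpp, mem_filter, mem_powerset, and_assoc]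
  refine ⟨fun h => h.2, fun h => ⟨fun c hc => ?_, h⟩⟩
  have := h.1.1 c hc
  simp only [mem_product, mem_range]
  exact this

/-- Columns increase strictly and the first row starts at least at the column number. -/
theorem add_add_one_le_of_mem_tableaux {n : ℕ} {μ : YoungDiagram} {T : SemistandardYoungTableau μ}
    (hT : T ∈ tableaux μ n) {c : ℕ} : ∀ {r}, (r, c) ∈ μ → r + c + 1 ≤ T r c := by
  intro r
  induction r with
  | zero => intro h; have := mem_tableaux.1 hT _ _ h; omega
  | succ r ih =>
    intro h
    have h1 := ih (μ.up_left_mem (Nat.le_succ r) le_rfl h)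
    have h2 := T.col_strict (Nat.lt_succ_self r) h
    simp only [Nat.succ_eq_add_one] at h2
    omega

theorem add_le_of_mem {μ : YoungDiagram} (T : SemistandardYoungTableau μ) {r c : ℕ} :
    ∀ d, (r + d, c) ∈ μ → T r c + d ≤ T (r + d) c := by
  intro d
  induction d with
  | zero => exact fun _ => le_rfl
  | succ d ih =>
    intro h
    have h1 := ih (μ.up_left_mem (by omega) le_rfl h)
    have h2 := T.col_strict (show r + d < r + (d + 1) by omega) h
    omega

namespace Corresponds

variable {n : ℕ} {μ : YoungDiagram} {P : Finset (ℕ × ℕ × ℕ)} {T : SemistandardYoungTableau μ}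

theorem tableau_le {T' : SemistandardYoungTableau μ} (hT : T ∈ tableaux μ n)
    (h : Corresponds n P T) (h' : Corresponds n P T') {r c : ℕ} (hc : (r, c) ∈ μ) :
    T' r c ≤ T r c := by
  have h1 := add_add_one_le_of_mem_tableaux hT hc
  have h2 := (mem_tableaux.1 hT _ _ hc).2
  have h3 := (h r (T r c) c (by omega) h2 (by omega)).2 ⟨hc, le_rfl⟩
  exact ((h' r (T r c) c (by omega) h2 (by omega)).1 h3).2

theorem tableau_unique {T' : SemistandardYoungTableau μ} (hT : T ∈ tableaux μ n)
    (hT' : T' ∈ tableaux μ n) (h : Corresponds n P T) (h' : Corresponds n P T') : T = T' := by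
  ext r c
  by_cases hc : (r, c) ∈ μ
  · exact (tableau_le hT' h' h hc).antisymm (tableau_le hT h h' hc)
  · rw [T.zeros hc, T'.zeros hc]

theorem partition_unique {P' : Finset (ℕ × ℕ × ℕ)} (hP : IsTSSCPP n P) (hP' : IsTSSCPP n P')
    (h : Corresponds n P T) (h' : Corresponds n P' T) : P = P' := by
  refine hP.eq_of_forall_mem hP' fun i j k hij hj hk hk' => ?_
  have h1 := h (n - 1 - j) (n - 1 - j + i) (2 * n - 1 - k) (by omega) (by omega) (by omega)
  have h2 := h' (n - 1 - j) (n - 1 - j + i) (2 * n - 1 - k) (by omega) (by omega) (by omega)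
  rw [← h2, Nat.add_sub_cancel_left, show n - 1 - (n - 1 - j) = j by omega,
    show 2 * n - 1 - (2 * n - 1 - k) = k by omega] at h1
  exact not_iff_not.1 h1

/-- By `Corresponds` for `v = n - 1` and `v = n - 2`, the entries `n - 1` in row `n - 2 - i` of the
tableau match the cubes over `(i, i + 1)` which are not over `(i + 1, i + 1)`. -/
theorem card_row_top (hP : IsTSSCPP n P) (hT : T ∈ tableaux μ n) (h : Corresponds n P T) {i : ℕ}
    (hi : i + 1 < n) :
    ((μ.cells.filter fun c => T c.1 c.2 + 1 = n).filter fun c => c.1 = n - 2 - i).card =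
      ppHeight P i (i + 1) - ppHeight P (i + 1) (i + 1) := by
  rw [← Nat.card_Ico (ppHeight P (i + 1) (i + 1))]
  have hIco : ∀ k, k ∈ Ico (ppHeight P (i + 1) (i + 1)) (ppHeight P i (i + 1)) ↔
      (i + 1, i + 1, k) ∉ P ∧ (i, i + 1, k) ∈ P := by
    intro k
    rw [mem_Ico, hP.mem_iff_lt_ppHeight, hP.mem_iff_lt_ppHeight, not_lt]
  have hcell : ∀ c < n, 2 * n - 1 - c ∈
      Ico (ppHeight P (i + 1) (i + 1)) (ppHeight P i (i + 1)) ↔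
        (n - 2 - i, c) ∈ μ ∧ T (n - 2 - i) c + 1 = n := by
    intro c hc
    have h1 := h (n - 2 - i) (n - 1) c (by omega) (by omega) hc
    have h2 := h (n - 2 - i) (n - 2) c (by omega) (by omega) hc
    rw [show n - 1 - (n - 2 - i) = i + 1 by omega] at h1 h2
    rw [show n - 2 - (n - 2 - i) = i by omega] at h2
    rw [hIco, h1, ← not_not (a := (i, i + 1, 2 * n - 1 - c) ∈ P), h2]
    constructor
    · rintro ⟨⟨h3, h4⟩, h5⟩
      refine ⟨h3, ?_⟩
      have : ¬ T (n - 2 - i) c ≤ n - 2 := fun h6 => h5 ⟨h3, h6⟩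
      omega
    · rintro ⟨h3, h4⟩
      exact ⟨⟨h3, by omega⟩, fun h5 => by omega⟩
  refine card_nbij' (fun c => 2 * n - 1 - c.2) (fun k => (n - 2 - i, 2 * n - 1 - k)) ?_ ?_ ?_ ?_
  · rintro ⟨r, c⟩ hrc
    simp only [coe_filter, mem_filter, Set.mem_ofPred_eq, YoungDiagram.mem_cells] at hrc
    obtain ⟨⟨hμ, hTn⟩, rfl⟩ := hrc
    have := (mem_tableaux.1 hT _ _ hμ)
    exact mem_coe.2 ((hcell c (by omega)).2 ⟨hμ, hTn⟩)
  · intro k hk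
    have hk := mem_coe.1 hk
    obtain ⟨hk1, hk2⟩ := (hIco k).1 hk
    have hkn : n ≤ k := by
      by_contra hlt
      exact hk1 (hP.mem_of_lt (by omega) (by omega) (by omega))
    have hk2 := (hP.1 _ hk2).2.2
    simp only at hk2
    have := (hcell (2 * n - 1 - k) (by omega)).1
      (by rwa [show 2 * n - 1 - (2 * n - 1 - k) = k by omega])
    simp only [coe_filter, mem_filter, Set.mem_ofPred_eq, YoungDiagram.mem_cells, and_true]
    exact this
  · rintro ⟨r, c⟩ hrc
    simp only [coe_filter, mem_filter, Set.mem_ofPred_eq, YoungDiagram.mem_cells] at hrc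
    obtain ⟨⟨hμ, hTn⟩, rfl⟩ := hrc
    have := (mem_tableaux.1 hT _ _ hμ)
    simp only [Prod.mk.injEq, true_and]
    omega
  · intro k hk
    have hk2 := (hP.1 _ ((hIco k).1 (mem_coe.1 hk)).2).2.2
    simp only at hk2 ⊢
    omega

theorem sum_ppHeight_sub (hP : IsTSSCPP n P) (hT : T ∈ tableaux μ n) (hμ : μ ≤ staircase n)
    (h : Corresponds n P T) :
    ∑ i ∈ range (n - 1), (ppHeight P i (i + 1) - ppHeight P (i + 1) (i + 1)) = topCount n T := by
  have hmaps : ∀ c ∈ μ.cells.filter (fun c => T c.1 c.2 + 1 = n), c.1 ∈ range (n - 1) := by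
    rintro ⟨r, c⟩ hc
    have := add_lt_of_le_staircase hμ (mem_filter.1 hc).1
    exact mem_range.2 (by simp only; omega)
  rw [topCount, card_eq_sum_card_fiberwise hmaps, ← sum_range_reflect]
  refine sum_congr rfl fun i hi => ?_
  have hi := mem_range.1 hi
  rw [← h.card_row_top hP hT (by omega), show n - 2 - (n - 1 - 1 - i) = i by omega]

end Corresponds

/-- The entry in the cell `(r, c)` is the least `v` for which the corresponding cube is missing. -/
theorem exists_tableau {n : ℕ} {μ : YoungDiagram} (hμ : μ ≤ staircase n)
    {P : Finset (ℕ × ℕ × ℕ)} (hP : P ∈ refinedTSSCPP n μ) :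
    ∃ T ∈ tableaux μ n, Corresponds n P T := by
  obtain ⟨hP, hdiag⟩ := mem_refinedTSSCPP.1 hP
  -- `q r c v` says that the entry in the cell `(r, c)` is to be at most `v`.
  let q : ℕ → ℕ → ℕ → Prop := fun r c v => r ≤ v ∧ (v - r, n - 1 - r, 2 * n - 1 - c) ∉ P
  have hqmono : ∀ {r c v v'}, v ≤ v' → q r c v → q r c v' := by
    rintro r c v v' hv ⟨h1, h2⟩
    exact ⟨h1.trans hv, fun h => h2 (hP.mem_of_le h (by omega) le_rfl le_rfl)⟩
  have hqtop : ∀ {r c}, r < n → c < n → (q r c (n - 1) ↔ (r, c) ∈ μ) := by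
    intro r c hr hc
    have h1 := hdiag (n - 1 - r) (by omega)
    rw [show n - 1 - (n - 1 - r) = r by omega] at h1
    simp only [q]
    rw [hP.mem_iff_lt_ppHeight, YoungDiagram.mem_iff_lt_rowLen]
    omega
  have hqlow : ∀ {r c v}, v < n → q r c v → r + c + 1 ≤ v := by
    rintro r c v hv ⟨h1, h2⟩
    by_contra h3
    exact h2 (hP.mem_of_add_le (by omega) (by omega))
  let e : ℕ → ℕ → ℕ := fun r c => sInf {v | q r c v}
  have he : ∀ {r c}, (r, c) ∈ μ → q r c (e r c) ∧ e r c < n := by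
    intro r c h
    have h1 := add_lt_of_le_staircase hμ h
    have h2 := (hqtop (by omega) (by omega)).2 h
    exact ⟨Nat.sInf_mem (s := {v | q r c v}) ⟨_, h2⟩,
      (Nat.sInf_le (s := {v | q r c v}) h2).trans_lt (by omega)⟩
  let T : SemistandardYoungTableau μ :=
    { entry := fun r c => if (r, c) ∈ μ then e r c else 0
      row_weak' := by
        intro r c1 c2 hc h
        rw [if_pos h, if_pos (μ.up_left_mem le_rfl hc.le h)]
        obtain ⟨⟨h1, h2⟩, -⟩ := he h
        exact Nat.sInf_le (s := {v | q r c1 v})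
          ⟨h1, fun h3 => h2 (hP.mem_of_le h3 le_rfl le_rfl (by omega))⟩
      col_strict' := by
        intro r1 r2 c hr h
        rw [if_pos h, if_pos (μ.up_left_mem hr.le le_rfl h)]
        obtain ⟨⟨h1, h2⟩, -⟩ := he h
        have h3 : e r1 c ≤ e r2 c - 1 := Nat.sInf_le (s := {v | q r1 c v})
          ⟨by omega, fun h3 => h2 (hP.mem_of_le h3 (by omega) (by omega) le_rfl)⟩
        omega
      zeros' := fun h => if_neg h }
  have hTe : ∀ {r c}, (r, c) ∈ μ → T r c = e r c := fun h => if_pos h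
  refine ⟨T, mem_tableaux.2 fun r c h => ?_, fun r v c hrv hv hc => ?_⟩
  · have h1 := he h
    have h2 := hqlow h1.2 h1.1
    rw [hTe h]
    omega
  · constructor
    · intro h
      have hq : q r c v := ⟨hrv, h⟩
      have hmem := (hqtop (by omega) hc).1 (hqmono (by omega) hq)
      rw [hTe hmem]
      exact ⟨hmem, Nat.sInf_le hq⟩
    · rintro ⟨hmem, h⟩
      rw [hTe hmem] at h
      exact (hqmono h (he hmem).1).2

/-- The relation `B` for `boxPartition` given by a tableau: the cube
`(i, j, 2n - 1 - c)` is missing if the cell `(n - 1 - max i j, c)` has an entry of size at most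
`n - 1 - |i - j|`. -/
def missingCubes (n : ℕ) {μ : YoungDiagram} (T : SemistandardYoungTableau μ) (i j c : ℕ) : Prop :=
  (n - 1 - max i j, c) ∈ μ ∧ T (n - 1 - max i j) c ≤ n - 1 - max i j + min i j

theorem exists_partition {n : ℕ} {μ : YoungDiagram} (hμ : μ ≤ staircase n)
    {T : SemistandardYoungTableau μ} (hT : T ∈ tableaux μ n) :
    ∃ P ∈ refinedTSSCPP n μ, Corresponds n P T := by
  have hsymm : ∀ i j c, missingCubes n T i j c ↔ missingCubes n T j i c := by
    intro i j c
    rw [missingCubes, missingCubes, max_comm, min_comm]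
  have hmono : ∀ i j c i' j' c', i ≤ i' → j ≤ j' → i' < n → j' < n → c' ≤ c →
      missingCubes n T i j c → missingCubes n T i' j' c' := by
    rintro i j c i' j' c' hi hj hi' hj' hc ⟨h1, h2⟩
    have hmem : (n - 1 - max i' j', c') ∈ μ := μ.up_left_mem (by omega) hc h1
    refine ⟨hmem, ?_⟩
    have h3 : n - 1 - max i j = n - 1 - max i' j' + (max i' j' - max i j) := by omega
    rw [h3] at h1 h2
    have h4 := add_le_of_mem T _ h1
    have h5 := T.row_weak_of_le hc (μ.up_left_mem (show n - 1 - max i' j' ≤ _ by omega) le_rfl h1)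
    omega
  have hbound : ∀ i j c, i < n → j < n → missingCubes n T i j c → c < i ∧ c < j := by
    rintro i j c hi hj ⟨h1, h2⟩
    have := add_add_one_le_of_mem_tableaux hT h1
    omega
  have hP := isTSSCPP_boxPartition hsymm hmono hbound
  have hmem : ∀ i j c, i < n → j < n → c < n →
      ((i, j, 2 * n - 1 - c) ∉ boxPartition n (missingCubes n T) ↔ missingCubes n T i j c) := by
    intro i j c hi hj hc
    rw [mem_boxPartition, and_iff_right (by omega), BoxMem,
      show 2 * n - 1 - (2 * n - 1 - c) = c by omega]
    have h1 : ¬ 2 * n - 1 - c < n := by omega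
    have h2 : n ≤ 2 * n - 1 - c := by omega
    simp [hi, hj, h1, h2, not_le.2 hi, not_le.2 hj]
  refine ⟨_, mem_refinedTSSCPP.2 ⟨hP, fun i hi => ?_⟩, fun r v c hrv hv hc => ?_⟩
  · have hrow := rowLen_le_of_le_staircase hμ (n - 1 - i)
    have hheight : ppHeight (boxPartition n (missingCubes n T)) i i =
        2 * n - μ.rowLen (n - 1 - i) := by
      refine eq_of_forall_lt_iff fun k => ?_
      rw [← hP.mem_iff_lt_ppHeight]
      by_cases hk : k < n
      · exact iff_of_true (hP.mem_of_lt hi hi hk) (by omega)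
      by_cases hk' : k < 2 * n
      · have h1 := hmem i i (2 * n - 1 - k) hi hi (by omega)
        rw [show 2 * n - 1 - (2 * n - 1 - k) = k by omega] at h1
        rw [← not_iff_not, h1, missingCubes, max_self, min_self]
        have h2 : ∀ c, (n - 1 - i, c) ∈ μ → T (n - 1 - i) c ≤ n - 1 - i + i := fun c hc => by
          have := (mem_tableaux.1 hT _ _ hc).2
          omega
        rw [and_iff_left_of_imp (h2 _), YoungDiagram.mem_iff_lt_rowLen]
        omega
      · refine iff_of_false (fun h => hk' (hP.1 _ h).2.2) (by omega)
    omega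
  · rw [hmem _ _ _ (by omega) (by omega) hc, missingCubes,
      show max (v - r) (n - 1 - r) = n - 1 - r by omega,
      show min (v - r) (n - 1 - r) = v - r by omega,
      show n - 1 - (n - 1 - r) = r by omega, show r + (v - r) = v by omega]

/-- Sums over plane partitions with diagonal `λ` are sums over tableaux of shape `λ`, the statistic
of the plane partition being the number of largest entries of the tableau. -/
theorem sum_refinedTSSCPP {R : Type*} [AddCommMonoid R] {n : ℕ} {μ : YoungDiagram}
    (hμ : μ ≤ staircase n) (f : ℕ → R) :
    ∑ P ∈ refinedTSSCPP n μ,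
        f (∑ i ∈ range (n - 1), (ppHeight P i (i + 1) - ppHeight P (i + 1) (i + 1))) =
      ∑ T ∈ tableaux μ n, f (topCount n T) := by
  choose F hF hcorr using fun P (hP : P ∈ refinedTSSCPP n μ) => exists_tableau hμ hP
  refine sum_bij F hF ?_ ?_ ?_
  · intro P hP P' hP' h
    have hcorr' := hcorr P' hP'
    rw [← h] at hcorr'
    exact (hcorr P hP).partition_unique (mem_refinedTSSCPP.1 hP).1 (mem_refinedTSSCPP.1 hP').1
      hcorr'
  · intro T hT
    obtain ⟨P, hP, h⟩ := exists_partition hμ hT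
    exact ⟨P, hP, (hcorr P hP).tableau_unique (hF P hP) hT h⟩
  · intro P hP
    rw [(hcorr P hP).sum_ppHeight_sub (mem_refinedTSSCPP.1 hP).1 (hF P hP) hμ]

theorem card_refinedTSSCPP {n : ℕ} {μ : YoungDiagram} (hμ : μ ≤ staircase n) :
    (refinedTSSCPP n μ).card = (tableaux μ n).card := by
  have h := sum_refinedTSSCPP hμ fun _ => 1
  rwa [sum_const, sum_const, smul_eq_mul, smul_eq_mul, mul_one, mul_one] at h

theorem refinedTSSCPPPoly_eq {n : ℕ} {μ : YoungDiagram} (hμ : μ ≤ staircase n) :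
    refinedTSSCPPPoly n μ = Polynomial.X ^ (n - 1 - μ.rowLen 0) * tableauPoly μ n := by
  rw [refinedTSSCPPPoly, sum_refinedTSSCPP hμ fun s => (Polynomial.X : Polynomial ℤ) ^ (n - 1 - s),
    tableauPoly, mul_sum]
  refine sum_congr rfl fun T _ => ?_
  have h1 := topCount_le (N := n) T
  have h2 := rowLen_le_of_le_staircase hμ 0
  rw [← pow_add]
  congr 1
  omega

/-! ### Divided differences and Schubert polynomials -/

theorem divDiff_eq {a : ℕ} {f g : MvPolynomial ℕ ℤ}
    (h : f - MvPolynomial.rename (Equiv.swap a (a + 1)) f =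
      (MvPolynomial.X a - MvPolynomial.X (a + 1)) * g) : divDiff a f = g := by
  have hne : (MvPolynomial.X a - MvPolynomial.X (a + 1) : MvPolynomial ℕ ℤ) ≠ 0 := by
    rw [sub_ne_zero]
    intro h
    have := MvPolynomial.X_injective h
    omega
  exact mul_left_cancel₀ hne ((Classical.choose_spec (divDiff_exists a f)).symm.trans h)

theorem rename_elemSymmOn (e : Equiv.Perm ℕ) (A : Finset ℕ) (k : ℤ) :
    MvPolynomial.rename e (elemSymmOn A k) = elemSymmOn (A.map e.toEmbedding) k := by
  unfold elemSymmOn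
  split_ifs
  · rw [powersetCard_map, sum_map, map_sum]
    refine sum_congr rfl fun S _ => ?_
    simp [map_prod]
  · exact map_zero _

theorem rename_swap_elemSymm {a m : ℕ} (ha : 1 ≤ a) (h : a ≠ m) (k : ℤ) :
    MvPolynomial.rename (Equiv.swap a (a + 1)) (elemSymm m k) = elemSymm m k := by
  rw [elemSymm_eq, rename_elemSymmOn]
  congr 1
  ext x
  rw [mem_map_equiv, Equiv.symm_swap, Equiv.swap_apply_def]
  split_ifs <;> simp only [mem_Icc] <;> omega

/-- This says that `∂_a e_k(X_a) = e_{k-1}(X_{a-1})`. -/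
theorem elemSymm_sub_rename (m : ℕ) (k : ℤ) :
    elemSymm (m + 1) k - MvPolynomial.rename (Equiv.swap (m + 1) (m + 1 + 1)) (elemSymm (m + 1) k) =
      (MvPolynomial.X (m + 1) - MvPolynomial.X (m + 1 + 1)) * elemSymm m (k - 1) := by
  rw [elemSymm_succ, map_add, map_mul, rename_swap_elemSymm (by omega) (by omega),
    rename_swap_elemSymm (by omega) (by omega), MvPolynomial.rename_X, Equiv.swap_apply_left]
  ring

/-- If all rows but row `p` are symmetric in `x_a` and `x_{a+1}`, the divided difference of the
determinant acts on row `p` alone. -/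
theorem divDiff_det {ι : Type*} [Fintype ι] [DecidableEq ι] {a : ℕ}
    (M : Matrix ι ι (MvPolynomial ℕ ℤ)) (p : ι) (G : ι → MvPolynomial ℕ ℤ)
    (hM : ∀ i, i ≠ p → ∀ j, MvPolynomial.rename (Equiv.swap a (a + 1)) (M i j) = M i j)
    (hG : ∀ j, M p j - MvPolynomial.rename (Equiv.swap a (a + 1)) (M p j) =
      (MvPolynomial.X a - MvPolynomial.X (a + 1)) * G j) :
    divDiff a M.det = (M.updateRow p G).det := by
  refine divDiff_eq ?_
  have h1 : MvPolynomial.rename (Equiv.swap a (a + 1)) M.det =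
      (M.updateRow p fun j => MvPolynomial.rename (Equiv.swap a (a + 1)) (M p j)).det := by
    rw [AlgHom.map_det]
    congr 1
    ext1 i j
    by_cases hi : i = p
    · subst hi; simp
    · simp [hi, hM i hi j]
  have h2 : M p = (fun j => MvPolynomial.rename (Equiv.swap a (a + 1)) (M p j)) +
      ((MvPolynomial.X a - MvPolynomial.X (a + 1) : MvPolynomial ℕ ℤ) • G) := by
    ext1 j
    simp only [Pi.add_apply, Pi.smul_apply, smul_eq_mul, ← hG j]
    ring
  have h3 := congrArg (fun R => (M.updateRow p R).det) h2
  simp only [Matrix.updateRow_eq_self, Matrix.det_updateRow_add, Matrix.det_updateRow_smul] at h3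
  rw [h1, h3]
  ring

/-- The determinant `det (e_{n-2i+j}(X_{n+k-i}))`, `1 ≤ i, j ≤ n`. -/
noncomputable def flagDet (n k : ℕ) : MvPolynomial ℕ ℤ :=
  (Matrix.of fun i j : Fin n => elemSymm (n + k - (i + 1)) ((n : ℤ) - 1 - 2 * i + j)).det

/-- The matrices of size `n + 1` that lead from `flagDet (n + 1) k` to `flagDet n (k + 1)`: in the
first `p` rows the degrees have been lowered by one. -/
noncomputable def stageMatrix (n k p : ℕ) : Matrix (Fin (n + 1)) (Fin (n + 1)) (MvPolynomial ℕ ℤ) :=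
  Matrix.of fun i j => elemSymm (n + k - i) ((n : ℤ) - 2 * i + j - if (i : ℕ) < p then 1 else 0)

theorem det_stageMatrix_zero (n k : ℕ) : (stageMatrix n k 0).det = flagDet (n + 1) k := by
  rw [flagDet]
  congr 1
  ext1 i j
  simp only [stageMatrix, Matrix.of_apply, Nat.not_lt_zero, if_false]
  congr 1
  · omega
  · push_cast; ring

theorem det_stageMatrix_last (n k : ℕ) : (stageMatrix n k n).det = flagDet n (k + 1) := by
  rw [Matrix.det_succ_row _ (Fin.last n), Fin.sum_univ_castSucc, sum_eq_zero, zero_add, flagDet]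
  · simp only [Fin.succAbove_last]
    have h : stageMatrix n k n (Fin.last n) (Fin.last n) = 1 := by
      simp only [stageMatrix, Matrix.of_apply, Fin.val_last, lt_irrefl, if_false]
      rw [show (n : ℤ) - 2 * n + n - 0 = 0 by ring, elemSymm_eq, elemSymmOn_zero]
    rw [h, Fin.val_last, ← two_mul, pow_mul]
    simp only [even_two, Even.neg_pow, one_pow, one_mul]
    congr 1
    ext1 i j
    simp only [stageMatrix, Matrix.submatrix_apply, Matrix.of_apply, Fin.val_castSucc, i.2, if_true]
    congr 1
    · omega
    · ring
  · intro j _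
    have := j.2
    have h : stageMatrix n k n (Fin.last n) j.castSucc = 0 := by
      simp only [stageMatrix, Matrix.of_apply, Fin.val_last, lt_irrefl, if_false, Fin.val_castSucc]
      exact elemSymmOn_neg _ (by omega)
    rw [h]
    simp

/-- The divided difference turns row `p` into `e_{d-1}(X_{a-1})`, where `a = n + k - p`. The next
row is `e_{d-2}(X_{a-1})`; adding `x_a` times this row gives `e_{d-1}(X_a)`. -/
theorem divDiff_det_stageMatrix {n p : ℕ} (k : ℕ) (hp : p < n) :
    divDiff (n + k - p) (stageMatrix n k p).det = (stageMatrix n k (p + 1)).det := by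
  obtain ⟨m, hm⟩ : ∃ m, n + k - p = m + 1 := ⟨n + k - p - 1, by omega⟩
  let P : Fin (n + 1) := ⟨p, by omega⟩
  let Q : Fin (n + 1) := ⟨p + 1, by omega⟩
  have hPQ : P ≠ Q := by simp [P, Q]
  rw [hm, divDiff_det (stageMatrix n k p) P
    (fun j => elemSymm m ((n : ℤ) - 2 * p + j - 1)),
    ← Matrix.det_updateRow_add_smul_self _ hPQ (MvPolynomial.X (m + 1))]
  · congr 1
    ext1 i j
    by_cases hi : i = P
    · subst hi
      have h1 : n + k - (p + 1) = m := by omega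
      simp only [Matrix.updateRow_self, Matrix.updateRow_ne hPQ.symm, stageMatrix, Matrix.of_apply,
        Pi.add_apply, Pi.smul_apply, smul_eq_mul, P, Q, Nat.lt_succ_self, if_true, hm, h1,
        if_neg (show ¬ p + 1 < p by omega)]
      rw [elemSymm_succ, add_comm]
      congr 3
      push_cast
      ring
    · have h2 : (i : ℕ) ≠ p := fun h => hi (Fin.ext h)
      have h3 : (i : ℕ) < p + 1 ↔ (i : ℕ) < p := by omega
      simp only [Matrix.updateRow_ne hi, stageMatrix, Matrix.of_apply, h3]
  · intro i hi j
    have h2 : (i : ℕ) ≠ p := fun h => hi (Fin.ext h)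
    have := i.2
    exact rename_swap_elemSymm (by omega) (by omega) _
  · intro j
    simp only [stageMatrix, Matrix.of_apply, P, lt_irrefl, if_false, hm, sub_zero]
    exact elemSymm_sub_rename _ _

theorem schubert_eq_divDiff {N a : ℕ} {w : Equiv.Perm ℕ} (h1 : 1 ≤ a) (h2 : a < N)
    (h3 : w a < w (a + 1)) (hmax : ∀ b, a < b → b < N → w (b + 1) ≤ w b) :
    schubert N w = divDiff a (schubert N (w * Equiv.swap a (a + 1))) := by
  have ha : a ∈ ascents N w := mem_filter.2 ⟨mem_Ico.2 ⟨h1, h2⟩, h3⟩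
  have hm : (ascents N w).max' ⟨a, ha⟩ = a := by
    refine le_antisymm (max'_le _ _ _ fun b hb => ?_) (le_max' _ _ ha)
    obtain ⟨hb, hb'⟩ := mem_filter.1 hb
    by_contra hlt
    exact absurd (hmax b (not_le.1 hlt) (mem_Ico.1 hb).2) (not_le.2 hb')
  rw [schubert, dif_pos ⟨a, ha⟩, hm]

/-- The permutations that lead from `1^k × w₀^{(n+1)}` to `1^{k+1} × w₀^{(n)}`: the value `k + 1` is
moved from position `n + k + 1` to the left, one place at a time. -/
def stagePerm (n k : ℕ) : ℕ → Equiv.Perm ℕ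
  | 0 => richardson (n + 1) k
  | p + 1 => stagePerm n k p * Equiv.swap (n + k - p) (n + k - p + 1)

theorem richardson_apply (n k x : ℕ) :
    richardson n k x = if k < x ∧ x ≤ k + n then n + 2 * k + 1 - x else x := rfl

theorem stagePerm_apply (n k : ℕ) : ∀ p ≤ n, ∀ x, stagePerm n k p x =
    if x ≤ k ∨ n + k + 1 < x then x else if x + p ≤ n + k then n + 2 * k + 2 - x
      else if x + p = n + k + 1 then k + 1 else n + 2 * k + 3 - x := by
  intro p
  induction p with
  | zero =>
    intro _ x
    rw [stagePerm, richardson_apply]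
    split_ifs <;> omega
  | succ p ih =>
    intro hp x
    rw [stagePerm, Equiv.Perm.mul_apply, ih (by omega), Equiv.swap_apply_def]
    split_ifs <;> omega

theorem stagePerm_last (n k : ℕ) : stagePerm n k n = richardson n (k + 1) := by
  ext x
  rw [stagePerm_apply n k n le_rfl, richardson_apply]
  split_ifs <;> omega

theorem schubert_stagePerm_succ {n p : ℕ} (k : ℕ) (hp : p < n) :
    schubert (n + k + 1) (stagePerm n k (p + 1)) =
      divDiff (n + k - p) (schubert (n + k + 1) (stagePerm n k p)) := by
  rw [schubert_eq_divDiff (a := n + k - p)]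
  · rw [stagePerm, mul_assoc, Equiv.swap_mul_self, mul_one]
  · omega
  · omega
  · rw [stagePerm_apply _ _ _ hp, stagePerm_apply _ _ _ hp]
    split_ifs <;> omega
  · intro b hb hb'
    rw [stagePerm_apply _ _ _ hp, stagePerm_apply _ _ _ hp]
    split_ifs <;> omega

theorem flagDet_zero (n : ℕ) : flagDet n 0 = ∏ a ∈ Icc 1 n, MvPolynomial.X a ^ (n - a) := by
  rw [flagDet, Matrix.det_of_isLowerTriangular]
  · have hdiag : ∀ i : Fin n, (Matrix.of fun i j : Fin n =>
        elemSymm (n + 0 - (i + 1)) ((n : ℤ) - 1 - 2 * i + j)) i i =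
        ∏ a ∈ Icc 1 n, if a + i + 1 ≤ n then MvPolynomial.X a else 1 := by
      intro i
      have := i.2
      have h := elemSymmOn_card (Icc 1 (n + 0 - (i + 1)))
      rw [Nat.card_Icc] at h
      rw [← prod_filter, Matrix.of_apply, elemSymm_eq]
      refine (congrArg _ ?_).trans (h.trans (prod_congr ?_ fun _ _ => rfl))
      · omega
      · ext a
        simp only [mem_Icc, mem_filter]
        omega
    rw [prod_congr rfl fun i _ => hdiag i, prod_comm]
    refine prod_congr rfl fun a ha => ?_
    have := mem_Icc.1 ha
    rw [Fin.prod_univ_eq_prod_range (fun i => if a + i + 1 ≤ n then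
      (MvPolynomial.X a : MvPolynomial ℕ ℤ) else 1) n, ← prod_filter, prod_const]
    congr 1
    rw [← card_range (n - a)]
    congr 1
    ext i
    simp only [mem_filter, mem_range]
    omega
  · intro i j hij
    have : (i : ℕ) < j := hij
    have := j.2
    exact elemSymmOn_gt _ (by rw [Nat.card_Icc]; omega)

theorem schubert_richardson (k : ℕ) :
    ∀ n, schubert (n + k) (richardson n k) = flagDet n k := by
  induction k with
  | zero =>
    intro n
    rw [flagDet_zero, schubert, dif_neg]
    · rfl
    · rintro ⟨a, ha⟩
      obtain ⟨h1, h2⟩ := mem_filter.1 ha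
      have := mem_Ico.1 h1
      rw [richardson_apply, richardson_apply, if_pos (by omega), if_pos (by omega)] at h2
      omega
  | succ k ih =>
    intro n
    have hstage : ∀ p ≤ n,
        schubert (n + k + 1) (stagePerm n k p) = (stageMatrix n k p).det := by
      intro p
      induction p with
      | zero =>
        intro _
        rw [stagePerm, det_stageMatrix_zero, ← ih (n + 1)]
        congr 1
        omega
      | succ p ihp =>
        intro hp
        rw [schubert_stagePerm_succ k hp, ihp (by omega), divDiff_det_stageMatrix k hp]
    rw [← stagePerm_last, ← add_assoc, hstage n le_rfl, det_stageMatrix_last]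

theorem ratVar_ne_zero (a : ℕ) : ratVar a ≠ 0 := by
  rw [ratVar, Ne, IsFractionRing.to_map_eq_zero_iff]
  exact MvPolynomial.X_ne_zero a

/-- The identity `e_k(x_1⁻¹, …, x_m⁻¹) = e_{m-k}(x_1, …, x_m) / (x_1 ⋯ x_m)`. -/
theorem aeval_inv_elemSymm (m : ℕ) : ∀ k : ℤ,
    MvPolynomial.aeval (fun a => (ratVar a)⁻¹) (elemSymm m k) =
      (∏ a ∈ Icc 1 m, (ratVar a)⁻¹) *
        algebraMap (MvPolynomial ℕ ℤ) RatFun (elemSymm m (m - k)) := by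
  induction m with
  | zero =>
    intro k
    rw [elemSymm_eq, elemSymm_eq, Icc_eq_empty (by omega), elemSymmOn_empty, elemSymmOn_empty]
    by_cases h : k = 0
    · simp [h]
    · simp [h]
  | succ m ih =>
    intro k
    have hx := ratVar_ne_zero (m + 1)
    rw [elemSymm_succ, elemSymm_succ, map_add, map_mul, map_add, map_mul, ih, ih,
      prod_Icc_succ_top (by omega), MvPolynomial.aeval_X, ← ratVar]
    have h1 : ((m + 1 : ℕ) : ℤ) - k - 1 = m - k := by push_cast; ring
    have h2 : (m : ℤ) - (k - 1) = ((m + 1 : ℕ) : ℤ) - k := by push_cast; ring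
    rw [h1, h2]
    field_simp
    ring

theorem prod_flags_mul_monomialM (n k : ℕ) :
    monomialM n k * ∏ i : Fin n, ∏ a ∈ Icc 1 (n + k - (i + 1)), (ratVar a)⁻¹ = 1 := by
  have h1 : ∏ i : Fin n, ∏ a ∈ Icc 1 (n + k - (i + 1)), (ratVar a)⁻¹ =
      ∏ a ∈ Icc 1 (n + k), (ratVar a)⁻¹ ^ min n (n + k - a) := by
    rw [Fin.prod_univ_eq_prod_range (fun i => ∏ a ∈ Icc 1 (n + k - (i + 1)), (ratVar a)⁻¹) n]
    have h : ∀ i ∈ range n, ∏ a ∈ Icc 1 (n + k - (i + 1)), (ratVar a)⁻¹ =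
        ∏ a ∈ Icc 1 (n + k), if a + i + 1 ≤ n + k then (ratVar a)⁻¹ else 1 := by
      intro i hi
      have := mem_range.1 hi
      rw [← prod_filter]
      refine prod_congr ?_ fun _ _ => rfl
      ext a
      simp only [mem_Icc, mem_filter]
      omega
    rw [prod_congr rfl h, prod_comm]
    refine prod_congr rfl fun a ha => ?_
    have := mem_Icc.1 ha
    rw [← prod_filter, prod_const]
    congr 1
    rw [← card_range (min n (n + k - a))]
    congr 1
    ext i
    simp only [mem_filter, mem_range]
    omega
  have h2 : ∏ a ∈ Icc (k + 1) (n + k), (ratVar a)⁻¹ =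
      ∏ a ∈ Icc 1 (n + k), if k < a then (ratVar a)⁻¹ else 1 := by
    rw [← prod_filter]
    refine prod_congr ?_ fun _ _ => rfl
    ext a
    simp only [mem_Icc, mem_filter]
    omega
  rw [monomialM, h1, h2, ← prod_mul_distrib, ← prod_mul_distrib]
  refine prod_eq_one fun a ha => ?_
  have := mem_Icc.1 ha
  have hx := ratVar_ne_zero a
  split_ifs with h
  · rw [show min (n + k - a + 1) n = min n (n + k - a) + 1 by omega, inv_pow]
    field_simp
    exact pow_succ' _ _
  · rw [show min (n + k - a + 1) n = min n (n + k - a) by omega, inv_pow]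
    field_simp

theorem mem_rectangle {n k i j : ℕ} : (i, j) ∈ rectangle n k ↔ i < k ∧ j < n := by
  rw [← YoungDiagram.mem_cells]
  simp [rectangle]

theorem colMultiSchur_rectangle (n k : ℕ) :
    algebraMap (MvPolynomial ℕ ℤ) RatFun (colMultiSchur (rectangle n k) (n + k)) =
      monomialM n k *
        MvPolynomial.aeval (fun a => (ratVar a)⁻¹) (schubert (n + k) (richardson n k)) := by
  have hrow : (rectangle n k).rowLen 0 ≤ n := by
    by_contra h
    exact lt_irrefl n (mem_rectangle.1 (YoungDiagram.mem_iff_lt_rowLen.2 (not_le.1 h))).2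
  have hcol : ∀ j < n, (rectangle n k).colLen j = k := fun j hj =>
    eq_of_forall_lt_iff fun i => by
      rw [← YoungDiagram.mem_iff_lt_colLen, mem_rectangle, and_iff_left hj]
  have hdet : MvPolynomial.aeval (fun a => (ratVar a)⁻¹) (flagDet n k) =
      (∏ i : Fin n, ∏ a ∈ Icc 1 (n + k - (i + 1)), (ratVar a)⁻¹) *
        algebraMap (MvPolynomial ℕ ℤ) RatFun (colMultiSchur (rectangle n k) (n + k)) := by
    rw [colMultiSchur_eq_det hrow (Nat.le_add_right n k), RingHom.map_det, ← Matrix.det_mul_column,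
      flagDet, AlgHom.map_det]
    congr 1
    ext1 i j
    have := i.2
    simp only [AlgHom.mapMatrix_apply, RingHom.mapMatrix_apply, Matrix.map_apply, Matrix.of_apply,
      aeval_inv_elemSymm, hcol j j.2]
    congr 3
    omega
  rw [schubert_richardson, hdet, ← mul_assoc, prod_flags_mul_monomialM, one_mul]

theorem theorem5p6 :
    -- refined enumeration of totally symmetric self-complementary plane partitions
    (∀ (n : ℕ) (μ : YoungDiagram), 1 ≤ n → μ ≤ staircase n →
      (refinedTSSCPP n μ).card = (tableaux μ n).card ∧
      refinedTSSCPPPoly n μ = Polynomial.X ^ (n - 1 - μ.rowLen 0) * tableauPoly μ n ∧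
      pathPoly (n - 1) (endPoints n μ) = Polynomial.X ^ (n - 1 - μ.rowLen 0) * tableauPoly μ n) ∧
    -- binomial determinants
    (∀ (μ : YoungDiagram) (N : ℕ), μ.rowLen 0 ≤ N →
      ((tableaux μ N).card : ℤ) = binomDet μ N) ∧
    (∀ (μ : YoungDiagram) (N : ℕ), μ.rowLen 0 < N → tableauPoly μ N = binomDetT μ N) ∧
    -- column multi-Schur polynomials specialize to these numbers and polynomials
    (∀ (μ : YoungDiagram) (N : ℕ), μ.rowLen 0 ≤ N →
      MvPolynomial.eval (fun _ => (1 : ℤ)) (colMultiSchur μ N) = ((tableaux μ N).card : ℤ)) ∧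
    (∀ (μ : YoungDiagram) (N : ℕ), μ.rowLen 0 < N →
      (colMultiSchurT μ N).eval 1 = colMultiSchur μ N ∧
      (colMultiSchurT μ N).map (MvPolynomial.eval fun _ => (1 : ℤ)) = tableauPoly μ N) ∧
    -- nonnegativity
    (∀ (μ : YoungDiagram) (N : ℕ), μ.rowLen 0 ≤ N →
      ∀ d : ℕ →₀ ℕ, 0 ≤ (colMultiSchur μ N).coeff d) ∧
    -- rectangular partitions and Schubert polynomials
    (∀ n k : ℕ,
      algebraMap (MvPolynomial ℕ ℤ) RatFun (colMultiSchur (rectangle n k) (n + k)) =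
        monomialM n k *
          MvPolynomial.aeval (fun a => (ratVar a)⁻¹) (schubert (n + k) (richardson n k))) := by
  refine ⟨fun n μ hn hμ => ⟨card_refinedTSSCPP hμ, refinedTSSCPPPoly_eq hμ,
      pathPoly_endPoints hn hμ⟩,
    fun μ N h => card_tableaux_eq_binomDet h,
    fun μ N h => tableauPoly_eq_binomDetT h,
    fun μ N h => (eval_one_colMultiSchur μ N).trans (card_tableaux_eq_binomDet h).symm,
    fun μ N h => ⟨eval_one_colMultiSchurT h,
      (map_eval_one_colMultiSchurT μ N).trans (tableauPoly_eq_binomDetT h).symm⟩,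
    fun μ N h d => coeff_colMultiSchur_nonneg h d,
    colMultiSchur_rectangle⟩
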